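/- Let $G=(\mathcal V,\mathcal E)$ be a finite connected simple graph and let $k_\lambda(x,y)$, $\lambda=(\beta^{-1},\alpha)$, $\beta>0$, $\alpha\in\mathcal A\subseteq\mathbb R^n$ open, be transition rates of a Markov jump process on $\mathcal V$, smooth in $\lambda$, with $k_\lambda(x,y)>0$ if $\{x,y\}\in\mathcal E$ and $k_\lambda(x,y)=0$ otherwise, satisfying local detailed balance: for $\{x,y\}\in\mathcal E$, $q_\alpha(x,y)=\frac1\beta\log\frac{k_\lambda(x,y)}{k_\lambda(y,x)}$ does not depend on $\beta$. Let $L_\lambda$ be the backward generator, $\rho^s_\lambda$ the unique stationary probability distribution, $\mathcal P_\lambda(x)=\sum_y k_\lambda(x,y)q_\alpha(x,y)$, $\langle\mathcal P_\lambda\rangle^s_\lambda=\sum_x\mathcal P_\lambda(x)\rho^s_\lambda(x)$, and define the quasipotential $$V_\lambda(x)=\int_0^\infty\Big(\big(e^{tL_\lambda}\mathcal P_\lambda\big)(x)-\langle\mathcal P_\lambda\rangle^s_\lambda\Big)\,dt .$$ Let $\phi_\alpha(x,y)=\lim_{\beta\to\infty}\frac1\beta\log k_\lambda(x,y)$ for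 $\{x,y\}\in\mathcal E$. For an oriented subgraph $D$ let $\phi_\alpha(D)$ be the sum of $\phi_\alpha$ over its oriented edges, and let $\phi^*_\alpha=\max_{z}\max_{T}\phi_\alpha(T_z)$, the maximum being over vertices $z$ and spanning trees $T$, where $T_z$ is $T$ with all edges directed towards $z$. A spanning tree-loop is a connected spanning subgraph of $G$ with exactly one loop (cycle). For $e\in\mathcal E$ let $O(\mathcal H^{(e)})$ be the set of oriented tree-loop-trees obtained as follows: take a spanning tree-loop containing $e$ such that $e$ is not on the loop; remove $e$, which leaves one component with the loop and one component that is a tree; orient the loop cyclically in one of its two directions, direct the other edges of its component towards the loop, and direct the edges of the tree component towards a root chosen in it. Let $S\subseteq\mathcal A$ be a set of parameters (for instance $S=\mathcal A$, or a single point) such that, uniformly in $\alpha\in S$, the heats are bounded, $\sup_{\alpha\in S}|q_\alpha(x,y)|<\infty$ for every edge, and the low-temperature asymptotics $k_\lambda(x,y)\simeq e^{\beta\phi_\alpha(x,y)}$ holds, in the sense that there are constants $c,C,\beta_0>0$ with $$c\,e^{\beta\phi_\alpha(x,y)}\le k_\lambda(x,y)\le C\,e^{\beta\phi_\alpha(x,y)}\qquad\text{for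 all }\beta\ge\beta_0,\ \alpha\in S,\ \{x,y\}\in\mathcal E .$$ Assume the no-delay condition (Condition 2): for every $\alpha\in S$, every $e\in\mathcal E$ and every $D\in O(\mathcal H^{(e)})$, $\phi_\alpha(D)\le\phi^*_\alpha$. Then the integral defining $V_\lambda(x)$ converges absolutely for all $\beta>0$, $\alpha\in\mathcal A$, $x\in\mathcal V$, and: (i) (edgewise boundedness) there are $B<\infty$ and $\beta_0>0$ such that $|V_\lambda(x)-V_\lambda(y)|\le B$ for all $\beta\ge\beta_0$, $\alpha\in S$ and every edge $\{x,y\}\in\mathcal E$; (ii) there are $B<\infty$ and $\beta_0>0$ such that $|V_\lambda(x)|\le B$ for all $\beta\ge\beta_0$, $\alpha\in S$ and $x\in\mathcal V$. -/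

import Mathlib

open Filter Topology MeasureTheory
open scoped ContDiff

noncomputable section

/-! ### Stationary distributions of finite rate matrices -/

/-- The stationary master equation
`∑_y k(x,y) v(x) = ∑_y k(y,x) v(y)` for a (not necessarily normalized) vector `v`. -/
def SolvesMasterEq {V : Type*} [Fintype V] (k : V → V → ℝ) (v : V → ℝ) : Prop :=
  ∀ x, ∑ y, k x y * v x = ∑ y, k y x * v y

/-- Stationary probability distributions of the jump process with rates `k`. -/
structure IsStationaryDist {V : Type*} [Fintype V] (k : V → V → ℝ) (ρ : V → ℝ) : Prop where
  nonneg : ∀ x, 0 ≤ ρ x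
  sum_eq_one : ∑ x, ρ x = 1
  master : SolvesMasterEq k ρ

theorem SolvesMasterEq.abs {V : Type*} [Fintype V] {k : V → V → ℝ} (hk : ∀ x y, 0 ≤ k x y)
    {v : V → ℝ} (hv : SolvesMasterEq k v) : SolvesMasterEq k (fun x => |v x|) := by
  have h1 : ∀ x ∈ Finset.univ, ∑ y, k x y * |v x| ≤ ∑ y, k y x * |v y| := by
    intro x _
    calc ∑ y, k x y * |v x| = |∑ y, k x y * v x| := by
          rw [← Finset.sum_mul, ← Finset.sum_mul, abs_mul,
            abs_of_nonneg (Finset.sum_nonneg fun y _ => hk x y)]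
      _ = |∑ y, k y x * v y| := by rw [hv x]
      _ ≤ ∑ y, |k y x * v y| := Finset.abs_sum_le_sum_abs _ _
      _ = ∑ y, k y x * |v y| := by
          refine Finset.sum_congr rfl fun y _ => ?_
          rw [abs_mul, abs_of_nonneg (hk y x)]
  have h2 : ∑ x, ∑ y, k x y * |v x| = ∑ x, ∑ y, k y x * |v y| := Finset.sum_comm
  intro x
  exact (Finset.sum_eq_sum_iff_of_le h1).1 h2 x (Finset.mem_univ x)

theorem SolvesMasterEq.add {V : Type*} [Fintype V] {k : V → V → ℝ} {v w : V → ℝ}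
    (hv : SolvesMasterEq k v) (hw : SolvesMasterEq k w) :
    SolvesMasterEq k (fun x => v x + w x) := by
  intro x
  simp only [mul_add, Finset.sum_add_distrib]
  rw [hv x, hw x]

theorem SolvesMasterEq.smul {V : Type*} [Fintype V] {k : V → V → ℝ} {v : V → ℝ} (c : ℝ)
    (hv : SolvesMasterEq k v) : SolvesMasterEq k (fun x => c * v x) := by
  intro x
  have := congrArg (fun t => c * t) (hv x)
  simp only [Finset.mul_sum] at this
  calc ∑ y, k x y * (c * v x) = ∑ y, c * (k x y * v x) :=
        Finset.sum_congr rfl fun y _ => by ring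
    _ = ∑ y, c * (k y x * v y) := this
    _ = _ := Finset.sum_congr rfl fun y _ => by ring

/-- A finite-state jump process has a stationary distribution. -/
theorem exists_isStationaryDist {V : Type*} [Fintype V] [Nonempty V] {k : V → V → ℝ}
    (hk : ∀ x y, 0 ≤ k x y) : ∃ ρ, IsStationaryDist k ρ := by
  classical
  let A : Matrix V V ℝ := Matrix.of fun x y => k y x - if x = y then ∑ z, k x z else 0
  have hdet : A.det = 0 := by
    rw [← Matrix.exists_vecMul_eq_zero_iff]
    refine ⟨fun _ => 1, ?_, ?_⟩
    · intro h
      obtain ⟨x⟩ := (inferInstance : Nonempty V)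
      exact one_ne_zero (congrFun h x)
    · ext y
      simp [Matrix.vecMul, dotProduct, A, Finset.sum_sub_distrib]
  obtain ⟨v, hv0, hv⟩ := Matrix.exists_mulVec_eq_zero_iff.2 hdet
  have hm : SolvesMasterEq k v := by
    intro x
    have := congrFun hv x
    simp only [Matrix.mulVec, dotProduct, A, Matrix.of_apply, sub_mul, Finset.sum_sub_distrib,
      ite_mul, zero_mul, Finset.sum_ite_eq, Finset.mem_univ, if_true, Pi.zero_apply] at this
    rw [← Finset.sum_mul]
    linarith
  have habs := hm.abs hk
  have hpos : 0 < ∑ x, |v x| := by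
    obtain ⟨x, hx⟩ := Function.ne_iff.1 hv0
    exact Finset.sum_pos' (fun y _ => abs_nonneg _) ⟨x, Finset.mem_univ x, abs_pos.2 hx⟩
  refine ⟨fun x => (∑ x, |v x|)⁻¹ * |v x|, ⟨fun x => by positivity, ?_, habs.smul _⟩⟩
  rw [← Finset.mul_sum, inv_mul_cancel₀ hpos.ne']

/-- The stationary distribution of a jump process on a finite state space
(unique when the process is irreducible, see `JumpModel.isStationaryDist_unique`). -/
def stationaryDist {V : Type*} [Fintype V] (k : V → V → ℝ) : V → ℝ :=
  Classical.epsilon (IsStationaryDist k)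

/-! ### Graph elements -/

/-- `T` is a spanning tree of `G`. -/
def IsSpanningTree {V : Type*} (G T : SimpleGraph V) : Prop := T ≤ G ∧ T.IsTree

/-- `C` is the edge set of a loop (cycle) of the graph `H`. -/
def IsLoop {V : Type*} (H : SimpleGraph V) (C : Set (Sym2 V)) : Prop :=
  ∃ (v : V) (p : H.Walk v v), p.IsCycle ∧ {e | e ∈ p.edges} = C

/-- `H` is a spanning tree-loop of `G`: a connected spanning subgraph with exactly one loop. -/
def IsSpanningTreeLoop {V : Type*} (G H : SimpleGraph V) : Prop :=
  H ≤ G ∧ H.Connected ∧ ∃! C, IsLoop H C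

/-- The spanning tree-loops of `G` that have the edge `e` in a tree, that is, `e` is an edge of
the tree-loop that is not on its loop. -/
def treeLoopsWithTreeEdge {V : Type*} (G : SimpleGraph V) (e : Sym2 V) : Set (SimpleGraph V) :=
  {H | IsSpanningTreeLoop G H ∧ e ∈ H.edgeSet ∧ ∀ C, IsLoop H C → e ∉ C}

/-- The spanning tree-loop-trees obtained by removing `e` from a spanning tree-loop having
`e` in a tree. -/
def treeLoopTrees {V : Type*} (G : SimpleGraph V) (e : Sym2 V) : Set (SimpleGraph V) :=
  {K | ∃ H ∈ treeLoopsWithTreeEdge G e, K = H.deleteEdges {e}}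

/-- `(u, v)` is an edge of `K` which, oriented from `u` to `v`, is directed towards the set `R`:
it is the first step of a path of `K` from `u` to a vertex of `R`. -/
def DirectedTowards {V : Type*} (K : SimpleGraph V) (R : Set V) (u v : V) : Prop :=
  ∃ r ∈ R, ∃ (h : K.Adj u v) (p : K.Walk v r), (SimpleGraph.Walk.cons h p).IsPath

open Classical in
/-- The rooted tree `T_z`, as a set of oriented edges: all edges of `T` directed towards `z`. -/
def rootedTree {V : Type*} [Fintype V] (T : SimpleGraph V) (z : V) : Finset (V × V) :=
  Finset.univ.filter fun a => DirectedTowards T {z} a.1 a.2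

open Classical in
/-- The oriented tree-loop-tree obtained from `K` by running through its loop along the closed
walk `p`, directing the other edges of the tree-loop part towards the loop, and directing
the edges of the tree part towards the root `r`. -/
def orientedTreeLoopTree {V : Type*} [Fintype V] (K : SimpleGraph V) {v : V} (p : K.Walk v v)
    (r : V) : Finset (V × V) :=
  Finset.univ.filter fun a =>
    (∃ d ∈ p.darts, d.toProd = a) ∨
      (s(a.1, a.2) ∉ p.edges ∧ DirectedTowards K ({u | u ∈ p.support} ∪ {r}) a.1 a.2)

/-- All orientations of a tree-loop-tree `K`: choose a direction of the loop (through the cyclic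
walk `p`) and a root `r` in the tree part, i.e. in the component not containing the loop. -/
def orientationsOf {V : Type*} [Fintype V] (K : SimpleGraph V) : Set (Finset (V × V)) :=
  {D | ∃ (v : V) (p : K.Walk v v) (r : V),
    p.IsCycle ∧ ¬ K.Reachable v r ∧ D = orientedTreeLoopTree K p r}

/-- The set of all oriented spanning tree-loop-trees made by removing `e` from a spanning
tree-loop of `G` with `e` in a tree. -/
def orientedTreeLoopTrees {V : Type*} [Fintype V] (G : SimpleGraph V) (e : Sym2 V) :
    Set (Finset (V × V)) :=
  {D | ∃ K ∈ treeLoopTrees G e, D ∈ orientationsOf K}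

/-! ### The jump processes -/

/-- A family of Markov jump processes on a finite connected simple graph, indexed by the inverse
temperature `β > 0` and by parameters `α` in an open set `params ⊆ ℝⁿ`, satisfying local
detailed balance with a `β`-independent heat `heat α x y`. -/
structure JumpModel (V : Type*) [Fintype V] (n : ℕ) where
  graph : SimpleGraph V
  connected : graph.Connected
  params : Set (EuclideanSpace ℝ (Fin n))
  isOpen_params : IsOpen params
  /-- `rate β α x y` is the transition rate from `x` to `y`. -/
  rate : ℝ → EuclideanSpace ℝ (Fin n) → V → V → ℝ
  rate_pos : ∀ β > 0, ∀ α ∈ params, ∀ x y, graph.Adj x y → 0 < rate β α x y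
  rate_eq_zero : ∀ β > 0, ∀ α ∈ params, ∀ x y, ¬ graph.Adj x y → rate β α x y = 0
  /-- Smoothness in `(β⁻¹, α)`. -/
  rate_smooth : ∀ x y, ContDiffOn ℝ ∞
    (fun l : ℝ × EuclideanSpace ℝ (Fin n) => rate l.1⁻¹ l.2 x y) (Set.Ioi 0 ×ˢ params)
  /-- `heat α x y` is the heat to the bath in the transition `x → y`; only its values on
  edges matter. -/
  heat : EuclideanSpace ℝ (Fin n) → V → V → ℝ
  local_detailed_balance : ∀ β > 0, ∀ α ∈ params, ∀ x y, graph.Adj x y →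
    1 / β * Real.log (rate β α x y / rate β α y x) = heat α x y

namespace JumpModel

variable {V : Type*} [Fintype V] {n : ℕ} (M : JumpModel V n)

theorem rate_nonneg {β : ℝ} (hβ : 0 < β) {α : EuclideanSpace ℝ (Fin n)} (hα : α ∈ M.params)
    (x y : V) : 0 ≤ M.rate β α x y := by
  by_cases h : M.graph.Adj x y
  · exact (M.rate_pos β hβ α hα x y h).le
  · exact (M.rate_eq_zero β hβ α hα x y h).ge

theorem isStationaryDist_stationaryDist {β : ℝ} (hβ : 0 < β) {α : EuclideanSpace ℝ (Fin n)}
    (hα : α ∈ M.params) : IsStationaryDist (M.rate β α) (stationaryDist (M.rate β α)) := by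
  have := M.connected.nonempty
  exact Classical.epsilon_spec (exists_isStationaryDist (M.rate_nonneg hβ hα))

/-- A nonnegative solution of the master equation that is positive somewhere is positive. -/
theorem pos_of_solvesMasterEq {β : ℝ} (hβ : 0 < β) {α : EuclideanSpace ℝ (Fin n)}
    (hα : α ∈ M.params) {v : V → ℝ} (h0 : ∀ x, 0 ≤ v x) (hv : SolvesMasterEq (M.rate β α) v)
    {x : V} (hx : 0 < v x) (y : V) : 0 < v y := by
  have step : ∀ a b, M.graph.Adj a b → 0 < v a → 0 < v b := by
    intro a b hab ha
    have h1 : 0 < ∑ z, M.rate β α z b * v z :=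
      Finset.sum_pos' (fun z _ => mul_nonneg (M.rate_nonneg hβ hα z b) (h0 z))
        ⟨a, Finset.mem_univ a, mul_pos (M.rate_pos β hβ α hα a b hab) ha⟩
    rw [← hv b, ← Finset.sum_mul] at h1
    exact lt_of_le_of_ne (h0 b) fun h => by simp [← h] at h1
  obtain ⟨p⟩ := M.connected.preconnected x y
  induction p with
  | nil => exact hx
  | cons h _ ih => exact ih (step _ _ h hx)

/-- The stationary distribution is unique. -/
theorem isStationaryDist_unique {β : ℝ} (hβ : 0 < β) {α : EuclideanSpace ℝ (Fin n)}
    (hα : α ∈ M.params) {ρ σ : V → ℝ} (hρ : IsStationaryDist (M.rate β α) ρ)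
    (hσ : IsStationaryDist (M.rate β α) σ) : ρ = σ := by
  have hv : SolvesMasterEq (M.rate β α) (fun x => ρ x + (-1) * σ x) :=
    hρ.master.add (hσ.master.smul (-1))
  have hsum : ∑ x, (ρ x + (-1) * σ x) = 0 := by
    rw [Finset.sum_add_distrib, ← Finset.mul_sum, hρ.sum_eq_one, hσ.sum_eq_one]; norm_num
  have hw := hv.add (hv.abs (M.rate_nonneg hβ hα))
  have hle : ∀ x ∈ Finset.univ, ρ x + (-1) * σ x ≤ 0 := by
    intro x _
    by_contra! hx
    have hx' : 0 < (ρ x + (-1) * σ x) + |ρ x + (-1) * σ x| := by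
      have := abs_nonneg (ρ x + (-1) * σ x); linarith
    have hall := M.pos_of_solvesMasterEq hβ hα
      (fun y => by have := neg_abs_le (ρ y + (-1) * σ y); linarith) hw hx'
    have hpos : ∀ y, 0 < ρ y + (-1) * σ y := by
      intro y
      by_contra! hy
      have := hall y
      rw [abs_of_nonpos hy] at this
      linarith
    have : 0 < ∑ y, (ρ y + (-1) * σ y) :=
      Finset.sum_pos (fun y _ => hpos y) ⟨x, Finset.mem_univ x⟩
    linarith
  have hz := (Finset.sum_eq_zero_iff_of_nonpos hle).1 hsum
  funext x
  have := hz x (Finset.mem_univ x)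
  linarith

open Classical in
/-- The backward generator: `L(x,y) = k(x,y)` off the diagonal, `L(x,x) = -∑_y k(x,y)`. -/
def generator (β : ℝ) (α : EuclideanSpace ℝ (Fin n)) : Matrix V V ℝ :=
  Matrix.of fun x y => if x = y then -∑ z, M.rate β α x z else M.rate β α x y

/-- The expected instantaneous power `P(x) = ∑_y k(x,y) q(x,y)`. -/
def power (β : ℝ) (α : EuclideanSpace ℝ (Fin n)) (x : V) : ℝ :=
  ∑ y, M.rate β α x y * M.heat α x y

/-- The stationary dissipated power `⟨P⟩ˢ`. -/
def meanPower (β : ℝ) (α : EuclideanSpace ℝ (Fin n)) : ℝ :=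
  ∑ x, M.power β α x * stationaryDist (M.rate β α) x

open Classical in
/-- `⟨P(X_t) | X_0 = x⟩ - ⟨P⟩ˢ`, where the process has the transition semigroup `e^{tL}`. -/
def excessPower (β : ℝ) (α : EuclideanSpace ℝ (Fin n)) (x : V) (t : ℝ) : ℝ :=
  (NormedSpace.exp (t • M.generator β α)).mulVec (M.power β α) x - M.meanPower β α

/-- The quasipotential `V(x) = ∫₀^∞ (⟨P(X_t) | X_0 = x⟩ - ⟨P⟩ˢ) dt`. -/
def quasipotential (β : ℝ) (α : EuclideanSpace ℝ (Fin n)) (x : V) : ℝ :=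
  ∫ t in Set.Ioi (0 : ℝ), M.excessPower β α x t

/-- `φ_α(x,y) = lim_{β → ∞} (1/β) log k(x,y)`. -/
def phi (α : EuclideanSpace ℝ (Fin n)) (x y : V) : ℝ :=
  limUnder atTop fun β : ℝ => 1 / β * Real.log (M.rate β α x y)

/-- `φ_α` of an oriented subgraph: the sum over its oriented edges. -/
def phiSub (α : EuclideanSpace ℝ (Fin n)) (D : Finset (V × V)) : ℝ :=
  ∑ a ∈ D, M.phi α a.1 a.2

/-- `φ_α(z) = max_T φ_α(T_z)` over the (finitely many) spanning trees `T`. -/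
def phiVertex (α : EuclideanSpace ℝ (Fin n)) (z : V) : ℝ :=
  ⨆ T : {T : SimpleGraph V // IsSpanningTree M.graph T}, M.phiSub α (rootedTree T.1 z)

/-- `φ*_α = max_z φ_α(z)`. -/
def phiStar (α : EuclideanSpace ℝ (Fin n)) : ℝ :=
  ⨆ z : V, M.phiVertex α z

/-- Low-temperature asymptotics `k(x,y) ≃ e^{β φ_α(x,y)}` of the rates, up to constant factors,
uniformly for `α ∈ S`. -/
def LowTemperatureAsymptotics (S : Set (EuclideanSpace ℝ (Fin n))) : Prop :=
  ∃ c > 0, ∃ C > 0, ∃ β₀ > 0, ∀ β ≥ β₀, ∀ α ∈ S, ∀ x y, M.graph.Adj x y →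
    c * Real.exp (β * M.phi α x y) ≤ M.rate β α x y ∧
      M.rate β α x y ≤ C * Real.exp (β * M.phi α x y)

/-- The no-delay condition, for the parameters in `S`: `φ_α(D) ≤ φ*_α` for every edge `e` and
every oriented tree-loop-tree `D` made by removing `e`. -/
def NoDelay (S : Set (EuclideanSpace ℝ (Fin n))) : Prop :=
  ∀ α ∈ S, ∀ e ∈ M.graph.edgeSet, ∀ D ∈ orientedTreeLoopTrees M.graph e,
    M.phiSub α D ≤ M.phiStar α

end JumpModel

end

/-! Up to a constant, the quasipotential at `x` is the mean heat released from `x` until an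
independent stationary target `z` is hit. Both ingredients are sums over self-maps `g` of the vertex
set fixing `z`, weighted by the product of `k v (g v)` over `v ≠ z`. Maps whose orbits all end at
`z` are the trees directed to `z`; they give `treeWeight` and, by the Markov chain tree theorem
`solvesMasterEq_treeWeight`, the stationary distribution. In `heatNumerator` a tree carries the heat
along its path from `x` to `z`, a map with exactly one cycle besides `z` carries the heat of that
cycle if `x` leads to it, and every other contribution is zero.

The core is the backward equation `sum_mul_heatNumerator_sub`. Take a map `g` with an extra arrow
from `x` to `y` and exchange that arrow with the one from `x` to `g x`: the product of rates is
unchanged, and the two defects cancel by `heatDefect_add_heatDefect`. Summing over `z` and using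
stationarity gives a Poisson equation (`sum_mul_sum_heatNumerator_sub`). The Poincaré inequality
makes the time integral converge and identifies it with the centred solution
(`integral_exp_smul_mulVec_sub`).

In the difference of the numerators across an edge `{x, y}`, only trees and one-cycle maps with
exactly one of `x`, `y` leading to the cycle survive. A cycle of length two has zero heat by
antisymmetry, so the latter maps are oriented tree-loop-trees made by removing `{x, y}`
(`mem_orientedTreeLoopTrees`). The no-delay condition bounds their weight by a constant times `exp
(β φ*)`, and the dominant tree shows that this is at most a constant times the total tree weight.
Dividing by that total gives the edgewise bound; connectedness and the vanishing stationary mean of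
the quasipotential then bound its values. -/

/-! ### Iteration of self-maps -/

section Iteration

open Classical Function

/-- The forward orbit of `a` under `g` contains `b`. -/
def Leads {V : Type*} (g : V → V) (a b : V) : Prop := ∃ n, g^[n] a = b

variable {V : Type*} {g : V → V} {a b c x y z : V}

namespace Leads

theorem refl (g : V → V) (a : V) : Leads g a a := ⟨0, rfl⟩

theorem step (g : V → V) (a : V) : Leads g a (g a) := ⟨1, rfl⟩

theorem trans (h : Leads g a b) (h' : Leads g b c) : Leads g a c := by
  obtain ⟨n, rfl⟩ := h
  obtain ⟨m, rfl⟩ := h'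
  exact ⟨m + n, iterate_add_apply g m n a⟩

theorem cases_head (h : Leads g a b) : a = b ∨ Leads g (g a) b := by
  obtain ⟨n, rfl⟩ := h
  cases n with
  | zero => exact Or.inl rfl
  | succ n => exact Or.inr ⟨n, rfl⟩

theorem of_map (h : Leads g (g a) b) : Leads g a b := (step g a).trans h

theorem map_iff (h : a ≠ b) : Leads g (g a) b ↔ Leads g a b :=
  ⟨of_map, fun h' => h'.cases_head.resolve_left h⟩

theorem eq_of_fixed (hz : g z = z) (h : Leads g z b) : b = z := by
  obtain ⟨n, rfl⟩ := h
  exact iterate_fixed hz n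

theorem map_iff_of_fixed (hz : g z = z) : Leads g (g a) z ↔ Leads g a z := by
  by_cases h : a = z
  · subst h; rw [hz]
  · exact map_iff h

theorem iff_of_fixed (hz : g z = z) (h : Leads g a b) : Leads g a z ↔ Leads g b z := by
  obtain ⟨n, rfl⟩ := h
  induction n generalizing a with
  | zero => rfl
  | succ n ih => rw [← map_iff_of_fixed hz]; exact ih

theorem induction_on {P : V → Prop} (h : Leads g a b) (ha : P b)
    (hs : ∀ u, u ≠ b → Leads g (g u) b → P (g u) → P u) : P a := by
  obtain ⟨n, hn⟩ := h
  induction n generalizing a with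
  | zero => exact (show a = b from hn) ▸ ha
  | succ n ih =>
    by_cases hab : a = b
    · exact hab ▸ ha
    · exact hs a hab ⟨n, hn⟩ (ih hn)

theorem mem_periodicPts (h : Leads g a b) (ha : a ∈ periodicPts g) : b ∈ periodicPts g := by
  obtain ⟨n, rfl⟩ := h
  obtain ⟨m, hm, hp⟩ := ha
  exact ⟨m, hm, hp.apply_iterate n⟩

theorem symm_of_mem_periodicPts (h : Leads g a b) (ha : a ∈ periodicPts g) : Leads g b a := by
  obtain ⟨n, rfl⟩ := h
  obtain ⟨m, hm, hp⟩ := ha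
  -- `m * n` is a multiple of the period `m` and at least `n`, so this many further steps close the
  -- orbit.
  refine ⟨m * n - n, ?_⟩
  rw [← iterate_add_apply, Nat.sub_add_cancel (Nat.le_mul_of_pos_left n hm)]
  exact hp.mul_const n

end Leads

theorem mem_periodicPts_iff_leads : a ∈ periodicPts g ↔ Leads g (g a) a := by
  constructor
  · intro h
    exact (Leads.step g a).symm_of_mem_periodicPts h
  · rintro ⟨n, hn⟩
    exact ⟨n + 1, n.succ_pos, hn⟩

/-- Pigeonhole: two iterates coincide, and the earlier one is periodic. -/
theorem exists_leads_mem_periodicPts [Finite V] (g : V → V) (a : V) :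
    ∃ b ∈ periodicPts g, Leads g a b := by
  obtain ⟨i, j, hij, h⟩ := Finite.exists_ne_map_eq_of_infinite fun n => g^[n] a
  wlog hlt : i < j generalizing i j
  · exact this j i hij.symm h.symm (lt_of_le_of_ne (not_lt.1 hlt) hij.symm)
  refine ⟨g^[i] a, ⟨j - i, Nat.sub_pos_of_lt hlt, ?_⟩, i, rfl⟩
  show g^[j - i] (g^[i] a) = g^[i] a
  rw [← iterate_add_apply, Nat.sub_add_cancel hlt.le]
  exact h.symm

/-- Changing the value at `x` affects an orbit only after it has reached `x`. -/
theorem Leads.update_iff : Leads (update g x y) a x ↔ Leads g a x := by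
  constructor
  · intro h
    refine h.induction_on (P := fun a => Leads g a x) (Leads.refl g x) fun u hu _ ih => ?_
    rw [update_of_ne hu] at ih
    exact ih.of_map
  · intro h
    refine h.induction_on (P := fun a => Leads (update g x y) a x) (Leads.refl _ x)
      fun u hu _ ih => ?_
    apply Leads.of_map
    rwa [update_of_ne hu]

theorem iterate_update_of_not_leads (h : ¬ Leads g a x) (n : ℕ) :
    (update g x y)^[n] a = g^[n] a := by
  induction n with
  | zero => rfl
  | succ n ih =>
    rw [iterate_succ_apply', iterate_succ_apply', ih, update_of_ne fun h' => h ⟨n, h'⟩]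

theorem leads_update_of_not_leads (h : ¬ Leads g a x) :
    Leads (update g x y) a b ↔ Leads g a b := by
  simp only [Leads, iterate_update_of_not_leads h]

theorem mem_periodicPts_update_of_not_leads (h : ¬ Leads g a x) :
    a ∈ periodicPts (update g x y) ↔ a ∈ periodicPts g := by
  simp only [periodicPts, IsPeriodicPt, IsFixedPt, iterate_update_of_not_leads h,
    Set.mem_ofPred_eq]

end Iteration

/-! ### Heat functionals of rooted maps -/

section RootedMaps

open Classical Function

variable {V : Type*} {g : V → V} {a b c x y z : V}

/-- Every forward orbit of `g` reaches `z`; if `g z = z`, then `g` is a spanning tree with all edges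
directed towards `z`. -/
def Rooted (g : V → V) (z : V) : Prop := ∀ v, Leads g v z

/-- The map `g` has at most one cycle avoiding `z`. -/
def AtMostOneCycle (g : V → V) (z : V) : Prop :=
  ∀ p ∈ periodicPts g, ∀ p' ∈ periodicPts g, p ≠ z → p' ≠ z → Leads g p p'

/-- The sum of `q` along the forward orbit of `a`. -/
noncomputable def orbitSum [Fintype V] (q : V → V → ℝ) (g : V → V) (a : V) : ℝ :=
  ∑ u with Leads g a u, q u (g u)

/-- The sum of `q` along all cycles of `g`. -/
noncomputable def cycleSum [Fintype V] (q : V → V → ℝ) (g : V → V) : ℝ :=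
  ∑ u with u ∈ periodicPts g, q u (g u)

/-- The heat assigned to the start `a` by a map `g` with root `z`: along the path from `a` to the
root if `g` is a tree, and along the cycle if `g` has one cycle and `a` leads to it. -/
noncomputable def heatTo [Fintype V] (q : V → V → ℝ) (z : V) (g : V → V) (a : V) : ℝ :=
  if Rooted g z then orbitSum q g a
  else if AtMostOneCycle g z ∧ ¬ Leads g a z then cycleSum q g else 0

theorem eq_of_leads_of_mem_periodicPts (hz : g z = z) (ha : a ∈ periodicPts g)
    (h : Leads g a z) : a = z :=
  Leads.eq_of_fixed hz (h.symm_of_mem_periodicPts ha)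

theorem mem_periodicPts_of_fixed (hz : g z = z) : z ∈ periodicPts g :=
  mem_periodicPts_iff_leads.2 (by rw [hz]; exact Leads.refl g z)

theorem rooted_iff [Finite V] (hz : g z = z) :
    Rooted g z ↔ ∀ p ∈ periodicPts g, p = z := by
  constructor
  · exact fun h p hp => eq_of_leads_of_mem_periodicPts hz hp (h p)
  · intro h v
    obtain ⟨b, hb, hvb⟩ := exists_leads_mem_periodicPts g v
    exact h b hb ▸ hvb

variable [Fintype V] {q : V → V → ℝ}

theorem orbitSum_eq_add (h : Rooted g z) (hz : g z = z) (ha : a ≠ z) :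
    orbitSum q g a = q a (g a) + orbitSum q g (g a) := by
  have hna : ¬ Leads g (g a) a := fun h' =>
    ha ((rooted_iff hz).1 h a (mem_periodicPts_iff_leads.2 h'))
  have : (Finset.univ.filter fun u => Leads g a u)
      = insert a (Finset.univ.filter fun u => Leads g (g a) u) := by
    ext u
    simp only [Finset.mem_filter, Finset.mem_univ, true_and, Finset.mem_insert]
    constructor
    · intro hu
      exact hu.cases_head.imp Eq.symm id
    · rintro (rfl | hu)
      · exact Leads.refl g u
      · exact hu.of_map
  rw [orbitSum, this, Finset.sum_insert (by simpa using hna), orbitSum]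

theorem heatTo_eq_add (h : Rooted g z) (hz : g z = z) (ha : a ≠ z) :
    heatTo q z g a = q a (g a) + heatTo q z g (g a) := by
  simp only [heatTo, if_pos h]
  exact orbitSum_eq_add h hz ha

theorem heatTo_eq_of_leads (h : ¬ Rooted g z) (hz : g z = z) (hab : Leads g a b) :
    heatTo q z g a = heatTo q z g b := by
  simp only [heatTo, if_neg h, hab.iff_of_fixed hz]

theorem heatTo_sub_eq_sum (h : Rooted g z) (hz : g z = z) (n : ℕ)
    (hn : ∀ i < n, g^[i] a ≠ z) :
    heatTo q z g a - heatTo q z g (g^[n] a) = ∑ i ∈ Finset.range n, q (g^[i] a) (g^[i + 1] a) := by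
  induction n with
  | zero => simp
  | succ n ih =>
    rw [Finset.sum_range_succ, ← ih fun i hi => hn i (hi.trans n.lt_succ_self)]
    have := heatTo_eq_add (q := q) h hz (hn n n.lt_succ_self)
    rw [iterate_succ_apply' g n a]
    linarith

/-- For a map with a single cycle besides the fixed point `z`. -/
theorem cycleSum_eq_sum_range (hq : ∀ v, q v v = 0) (hz : g z = z) (ha : a ∈ periodicPts g)
    (haz : a ≠ z) (h1 : AtMostOneCycle g z) :
    cycleSum q g = ∑ i ∈ Finset.range (minimalPeriod g a), q (g^[i] a) (g^[i + 1] a) := by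
  have hS : (Finset.univ.filter fun u => u ∈ periodicPts g)
      = insert z ((Finset.range (minimalPeriod g a)).image fun i => g^[i] a) := by
    ext u
    simp only [Finset.mem_filter, Finset.mem_univ, true_and, Finset.mem_insert, Finset.mem_image,
      Finset.mem_range]
    constructor
    · intro hu
      by_cases huz : u = z
      · exact Or.inl huz
      obtain ⟨n, hn⟩ := h1 a ha u hu haz huz
      exact Or.inr ⟨n % minimalPeriod g a,
        Nat.mod_lt _ (minimalPeriod_pos_of_mem_periodicPts ha), by
          rw [iterate_mod_minimalPeriod_eq, hn]⟩
    · rintro (rfl | ⟨n, -, rfl⟩)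
      · exact mem_periodicPts_of_fixed hz
      · exact Leads.mem_periodicPts ⟨n, rfl⟩ ha
  rw [cycleSum, hS, Finset.sum_insert, hz, hq, zero_add, Finset.sum_image]
  · simp only [iterate_succ_apply']
  · intro i hi j hj hij
    exact iterate_injOn_Iio_minimalPeriod (by simpa using hi) (by simpa using hj) hij
  · simp only [Finset.mem_image, not_exists, not_and]
    intro i _ hi
    exact haz (eq_of_leads_of_mem_periodicPts hz ha ⟨i, hi⟩)

/-- Here `x` lies on no cycle before or after its arrow is redirected, so both maps have the same
cycles, and the orbit of `a` never meets the changed arrow. -/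
theorem heatTo_update_of_not_leads (hz : g z = z) (hxz : x ≠ z) (hx : ¬ Leads g (g x) x)
    (hy : ¬ Leads g y x) (ha : ¬ Leads g a x) :
    heatTo q z (update g x y) a = heatTo q z g a ∧ (Rooted (update g x y) z ↔ Rooted g z) := by
  have hz' : update g x y z = z := by rw [update_of_ne hxz.symm, hz]
  have hn : ∀ v ∈ periodicPts g, ¬ Leads g v x := fun v hv h =>
    hx (mem_periodicPts_iff_leads.1 (h.mem_periodicPts hv))
  have hn' : ∀ v ∈ periodicPts (update g x y), ¬ Leads g v x := fun v hv h => by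
    have := mem_periodicPts_iff_leads.1 ((Leads.update_iff.2 h).mem_periodicPts hv)
    rw [update_self, Leads.update_iff] at this
    exact hy this
  have hP : ∀ v, v ∈ periodicPts (update g x y) ↔ v ∈ periodicPts g := fun v =>
    ⟨fun h => (mem_periodicPts_update_of_not_leads (hn' v h)).1 h,
      fun h => (mem_periodicPts_update_of_not_leads (hn v h)).2 h⟩
  have hR : Rooted (update g x y) z ↔ Rooted g z := by
    rw [rooted_iff hz, rooted_iff hz']
    simp only [hP]
  have hU : AtMostOneCycle (update g x y) z ↔ AtMostOneCycle g z := by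
    simp only [AtMostOneCycle, hP]
    refine forall₄_congr fun p hp p' hp' => ?_
    rw [leads_update_of_not_leads (hn p hp)]
  have hC : cycleSum q (update g x y) = cycleSum q g := by
    simp only [cycleSum, hP]
    refine Finset.sum_congr rfl fun u hu => ?_
    rw [update_of_ne]
    rintro rfl
    exact hn u (Finset.mem_filter.1 hu).2 (Leads.refl g u)
  have hO : orbitSum q (update g x y) a = orbitSum q g a := by
    simp only [orbitSum, leads_update_of_not_leads ha]
    refine Finset.sum_congr rfl fun u hu => ?_
    rw [update_of_ne]
    rintro rfl
    exact ha (Finset.mem_filter.1 hu).2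
  exact ⟨by simp only [heatTo, hR, hU, hC, hO, leads_update_of_not_leads ha], hR⟩

/-- The defect of the backward equation for `heatTo` along a step from `x` to `y`. -/
noncomputable def heatDefect (q : V → V → ℝ) (z x : V) (g : V → V) (y : V) : ℝ :=
  heatTo q z g x - heatTo q z g y - if Rooted g z then q x y else 0

theorem not_rooted_of_mem_periodicPts (hz : g z = z) (hxz : x ≠ z)
    (hx : x ∈ periodicPts g) : ¬ Rooted g z := fun h => hxz ((rooted_iff hz).1 h x hx)

theorem heatDefect_eq_zero_of_leads (hz : g z = z) (hxz : x ≠ z) (hx : Leads g (g x) x)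
    (hy : Leads g y x) : heatDefect q z x g y = 0 := by
  have := not_rooted_of_mem_periodicPts hz hxz (mem_periodicPts_iff_leads.2 hx)
  rw [heatDefect, if_neg this, heatTo_eq_of_leads this hz hy]
  ring

/-- Redirecting the arrow at `x` opens the cycle through `x`. If a tree results, its path from `g x`
to `x` together with the removed arrow is that cycle, so the cycle heat cancels. Otherwise `g` has a
further cycle avoiding `z`: all its heats vanish, and in the new map `g x` leads to `x`, so their
heats agree. -/
theorem heatDefect_add_of_leads (hq : ∀ v, q v v = 0) (hz : g z = z) (hxz : x ≠ z)
    (hx : Leads g (g x) x) (hy : ¬ Leads g y x) :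
    heatDefect q z x g y + heatDefect q z x (update g x y) (g x) = 0 := by
  have hz' : update g x y z = z := by rw [update_of_ne hxz.symm, hz]
  have hxp := mem_periodicPts_iff_leads.2 hx
  have hR := not_rooted_of_mem_periodicPts hz hxz hxp
  by_cases hR' : Rooted (update g x y) z
  · have hyz : Leads g y z := (leads_update_of_not_leads hy).1 (hR' y)
    have hP : ∀ p ∈ periodicPts g, p ≠ z → Leads g p x := by
      intro p hp hpz
      by_contra hpx
      exact hpz ((rooted_iff hz').1 hR' p ((mem_periodicPts_update_of_not_leads hpx).2 hp))
    have hU : AtMostOneCycle g z := fun p hp p' hp' h h' =>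
      (hP p hp h).trans ((hP p' hp' h').symm_of_mem_periodicPts hp')
    have hxz' : ¬ Leads g x z := fun h => hxz (eq_of_leads_of_mem_periodicPts hz hxp h)
    have h1 : heatTo q z g x = cycleSum q g := by
      rw [heatTo, if_neg hR, if_pos ⟨hU, hxz'⟩]
    have h2 : heatTo q z g y = 0 := by
      rw [heatTo, if_neg hR, if_neg fun h => h.2 hyz]
    obtain ⟨m, hm⟩ : ∃ m, minimalPeriod g x = m + 1 :=
      Nat.exists_eq_succ_of_ne_zero (minimalPeriod_pos_of_mem_periodicPts hxp).ne'
    have hit : ∀ i ≤ m, (update g x y)^[i] (g x) = g^[i + 1] x := by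
      intro i hi
      induction i with
      | zero => rfl
      | succ i ih =>
        rw [iterate_succ_apply', ih (by omega), iterate_succ_apply' g (i + 1), update_of_ne]
        intro h
        have := IsPeriodicPt.minimalPeriod_le i.succ_pos h
        omega
    have hend : (update g x y)^[m] (g x) = x := by
      rw [hit m le_rfl, ← hm, iterate_minimalPeriod]
    have h3 := heatTo_sub_eq_sum (q := q) (a := g x) hR' hz' m (by
      intro i hi h
      rw [hit i hi.le] at h
      exact hxz' ⟨i + 1, h⟩)
    rw [hend] at h3
    rw [heatDefect, heatDefect, if_neg hR, if_pos hR', h1, h2,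
      cycleSum_eq_sum_range hq hz hxp hxz hU, hm, Finset.sum_range_succ']
    have h4 : ∑ i ∈ Finset.range m, q ((update g x y)^[i] (g x)) ((update g x y)^[i + 1] (g x))
        = ∑ i ∈ Finset.range m, q (g^[i + 1] x) (g^[i + 1 + 1] x) := by
      refine Finset.sum_congr rfl fun i hi => ?_
      rw [hit i (Finset.mem_range.1 hi).le, hit (i + 1) (Finset.mem_range.1 hi)]
    rw [h4] at h3
    simp only [iterate_zero, id_eq, zero_add, iterate_one]
    linarith
  · have hnx : ¬ Leads (update g x y) y x := by rwa [Leads.update_iff]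
    have hU : ¬ AtMostOneCycle g z := by
      intro hU
      apply hR'
      rw [rooted_iff hz']
      intro p hp
      by_contra hpz
      have hpx : ¬ Leads g p x := fun h => by
        have h' := mem_periodicPts_iff_leads.1 ((Leads.update_iff.2 h).mem_periodicPts hp)
        rw [update_self] at h'
        exact hnx h'
      exact hpx (hU p ((mem_periodicPts_update_of_not_leads hpx).1 hp) x hxp hpz hxz)
    have h0 : ∀ a, heatTo q z g a = 0 := fun a => by
      rw [heatTo, if_neg hR, if_neg fun h => hU h.1]
    rw [heatDefect, heatDefect, if_neg hR, if_neg hR', h0, h0,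
      heatTo_eq_of_leads hR' hz' (Leads.update_iff.2 hx)]
    ring

/-- The cases are whether `x` is periodic for `g` and for the updated map. If for both, each defect
vanishes; if for one, a cycle is opened or closed, and `hback` makes these two cases symmetric; if
for neither, the heats at `g x` and `y` are unaffected by the exchange. -/
theorem heatDefect_add_heatDefect (hq : ∀ v, q v v = 0) (hz : g z = z) (hxz : x ≠ z) (y : V) :
    heatDefect q z x g y + heatDefect q z x (update g x y) (g x) = 0 := by
  have hz' : update g x y z = z := by rw [update_of_ne hxz.symm, hz]
  have hback : update (update g x y) x (g x) = g := by rw [update_idem, update_eq_self]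
  by_cases hx : Leads g (g x) x <;> by_cases hy : Leads g y x
  · rw [heatDefect_eq_zero_of_leads hz hxz hx hy, heatDefect_eq_zero_of_leads hz' hxz, add_zero]
    · rw [update_self, Leads.update_iff]; exact hy
    · rw [Leads.update_iff]; exact hx
  · exact heatDefect_add_of_leads hq hz hxz hx hy
  · have := heatDefect_add_of_leads (g := update g x y) (y := g x) hq hz' hxz
      (by rw [update_self, Leads.update_iff]; exact hy) (by rwa [Leads.update_iff])
    rw [hback, update_self] at this
    rw [add_comm]; exact this
  · obtain ⟨h1, hR⟩ := heatTo_update_of_not_leads (q := q) hz hxz hx hy hx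
    obtain ⟨h2, -⟩ := heatTo_update_of_not_leads (q := q) hz hxz hx hy hy
    simp only [heatDefect, hR, h1]
    by_cases h : Rooted g z
    · have e1 := heatTo_eq_add (q := q) h hz hxz
      have e2 := heatTo_eq_add (q := q) (hR.2 h) hz' hxz
      rw [update_self] at e2
      simp only [if_pos h]
      linarith
    · have e1 := heatTo_eq_of_leads (q := q) h hz (Leads.step g x)
      have e2 := heatTo_eq_of_leads (q := q) (mt hR.1 h) hz' (Leads.step _ x)
      rw [update_self] at e2
      simp only [if_neg h]
      linarith

end RootedMaps

/-! ### Weighted sums over rooted maps -/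

section WeightedSums

open Classical Function

variable {V : Type*} [Fintype V] {g : V → V} {x y z : V} {k q : V → V → ℝ}

/-- The product of the rates `k v (g v)` over `v ≠ z`. -/
noncomputable def rootedWeight (k : V → V → ℝ) (z : V) (g : V → V) : ℝ :=
  ∏ v ∈ Finset.univ.erase z, k v (g v)

/-- The total weight of the trees rooted at `z`. -/
noncomputable def treeWeight (k : V → V → ℝ) (z : V) : ℝ :=
  ∑ g : V → V with g z = z, if Rooted g z then rootedWeight k z g else 0

/-- The weighted sum of `heatTo` over all maps with root `z`. -/
noncomputable def heatNumerator (k q : V → V → ℝ) (z x : V) : ℝ :=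
  ∑ g : V → V with g z = z, rootedWeight k z g * heatTo q z g x

theorem rootedWeight_nonneg (hk : ∀ x y, 0 ≤ k x y) (z : V) (g : V → V) :
    0 ≤ rootedWeight k z g := Finset.prod_nonneg fun v _ => hk v (g v)

/-- Both sides multiply the rates of the same arrows: two leave `x`, and either may be counted as
the one belonging to the map. -/
theorem mul_rootedWeight_update (hxz : x ≠ z) :
    k x (g x) * rootedWeight k z (update g x y) = k x y * rootedWeight k z g := by
  have hx : x ∈ Finset.univ.erase z := by simp [hxz]
  rw [rootedWeight, rootedWeight, ← Finset.mul_prod_erase _ _ hx,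
    ← Finset.mul_prod_erase _ (fun v => k v (g v)) hx, update_self]
  have : ∏ v ∈ (Finset.univ.erase z).erase x, k v (update g x y v)
      = ∏ v ∈ (Finset.univ.erase z).erase x, k v (g v) :=
    Finset.prod_congr rfl fun v hv => by rw [update_of_ne (Finset.ne_of_mem_erase hv)]
  rw [this]
  ring

/-- The exchange `σ` of the extra arrow with the arrow of the map at `x` is an involution that flips
the sign of the summand, so the sum equals its own negative. -/
theorem sum_mul_rootedWeight_mul_heatDefect (hq : ∀ v, q v v = 0) (hxz : x ≠ z) :
    ∑ y, ∑ g : V → V with g z = z, k x y * rootedWeight k z g * heatDefect q z x g y = 0 := by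
  rw [← Finset.sum_product']
  set s := (Finset.univ : Finset V) ×ˢ (Finset.univ.filter fun g : V → V => g z = z) with hs
  have hmem : ∀ a : V × (V → V), a ∈ s ↔ a.2 z = z := by simp [hs]
  set F : V × (V → V) → ℝ := fun a => k x a.1 * rootedWeight k z a.2 * heatDefect q z x a.2 a.1
    with hF
  let σ : V × (V → V) → V × (V → V) := fun a => (a.2 x, update a.2 x a.1)
  have hσ : ∀ a ∈ s, σ a ∈ s := fun a ha => by
    rw [hmem] at ha ⊢
    show update a.2 x a.1 z = z
    rw [update_of_ne hxz.symm, ha]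
  have hσσ : ∀ a ∈ s, σ (σ a) = a := fun a _ => by
    show (update a.2 x a.1 x, update (update a.2 x a.1) x (a.2 x)) = a
    rw [update_self, update_idem, update_eq_self]
  have h1 : ∑ a ∈ s, F a = ∑ a ∈ s, F (σ a) :=
    Finset.sum_nbij' σ σ hσ hσ hσσ hσσ fun a ha => by rw [hσσ a ha]
  have h2 : ∑ a ∈ s, (F a + F (σ a)) = 0 := Finset.sum_eq_zero fun a ha => by
    show k x a.1 * rootedWeight k z a.2 * heatDefect q z x a.2 a.1 +
      k x (a.2 x) * rootedWeight k z (update a.2 x a.1) *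
        heatDefect q z x (update a.2 x a.1) (a.2 x) = 0
    rw [mul_rootedWeight_update hxz, ← mul_add,
      heatDefect_add_heatDefect hq ((hmem a).1 ha) hxz, mul_zero]
  rw [Finset.sum_add_distrib, ← h1] at h2
  show ∑ a ∈ s, F a = 0
  linarith

/-- The backward equation for the heat released on the way to `z`. -/
theorem sum_mul_heatNumerator_sub (hq : ∀ v, q v v = 0) (hxz : x ≠ z) :
    ∑ y, k x y * (heatNumerator k q z x - heatNumerator k q z y)
      = treeWeight k z * ∑ y, k x y * q x y := by
  rw [← sub_eq_zero, ← sum_mul_rootedWeight_mul_heatDefect (k := k) hq hxz, Finset.mul_sum,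
    ← Finset.sum_sub_distrib]
  refine Finset.sum_congr rfl fun y _ => ?_
  rw [heatNumerator, heatNumerator, treeWeight, ← Finset.sum_sub_distrib, Finset.mul_sum,
    Finset.sum_mul, ← Finset.sum_sub_distrib]
  refine Finset.sum_congr rfl fun g _ => ?_
  rw [heatDefect]
  split_ifs <;> ring

/-! ### The Markov chain tree theorem -/

theorem sum_eq_sum_update (x : V) (H : (V → V) → ℝ) :
    ∑ g, H g = ∑ g : V → V with g x = x, ∑ y, H (update g x y) := by
  rw [← Finset.sum_product']
  refine Finset.sum_nbij' (fun g => (update g x x, g x)) (fun a => update a.1 x a.2) ?_ ?_ ?_ ?_ ?_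
  · intro g _; simp
  · intro a _; simp
  · intro g _; simp
  · intro a ha
    have : a.1 x = x := by simpa using ha
    refine Prod.ext ?_ (by simp)
    show update (update a.1 x a.2) x x = a.1
    rw [update_idem]
    nth_rw 2 [← this]
    exact update_eq_self x a.1
  · intro g _; simp

omit [Fintype V] in
theorem Rooted.update_iff : Rooted (update g x y) x ↔ Rooted g x :=
  forall_congr' fun _ => Leads.update_iff

theorem prod_update (x y : V) (g : V → V) :
    ∏ v, k v (update g x y v) = k x y * rootedWeight k x g := by
  rw [← Finset.mul_prod_erase _ _ (Finset.mem_univ x), update_self, rootedWeight]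
  congr 1
  exact Finset.prod_congr rfl fun v hv => by rw [update_of_ne (Finset.ne_of_mem_erase hv)]

/-- Giving the root `x` of a tree an outgoing arrow produces each map whose orbits all reach `x`
exactly once. In the master equation the inflow is counted by the same maps. -/
theorem sum_mul_treeWeight (x : V) :
    ∑ y, k x y * treeWeight k x = ∑ g : V → V, if Rooted g x then ∏ v, k v (g v) else 0 := by
  rw [sum_eq_sum_update x, Finset.sum_comm]
  refine Finset.sum_congr rfl fun y _ => ?_
  rw [treeWeight, Finset.mul_sum]
  refine Finset.sum_congr rfl fun g _ => ?_
  rw [prod_update, Rooted.update_iff, mul_ite, mul_zero]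

theorem mul_treeWeight (x y : V) :
    k y x * treeWeight k y =
      ∑ g : V → V, if g y = x ∧ Rooted g y then ∏ v, k v (g v) else 0 := by
  rw [sum_eq_sum_update y, treeWeight, Finset.mul_sum]
  refine Finset.sum_congr rfl fun g _ => ?_
  simp only [prod_update, Rooted.update_iff, update_self, ite_and]
  rw [Finset.sum_ite_eq' Finset.univ x, if_pos (Finset.mem_univ x), mul_ite, mul_zero]

omit [Fintype V] in
-- Any such predecessor is periodic, since its own orbit returns to it, and `g` is injective on
-- periodic points.
theorem existsUnique_pred_of_rooted (h : Rooted g x) : ∃! y, g y = x ∧ Rooted g y := by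
  have hx : x ∈ periodicPts g := mem_periodicPts_iff_leads.2 (h _)
  obtain ⟨m, hm⟩ : ∃ m, minimalPeriod g x = m + 1 :=
    Nat.exists_eq_succ_of_ne_zero (minimalPeriod_pos_of_mem_periodicPts hx).ne'
  have hmx : g (g^[m] x) = x := by
    have := iterate_minimalPeriod (f := g) (x := x)
    rwa [hm, iterate_succ_apply'] at this
  refine ⟨g^[m] x, ⟨hmx, fun v => (h v).trans ⟨m, rfl⟩⟩, ?_⟩
  rintro y ⟨hy, hR⟩
  have hyp : y ∈ periodicPts g := mem_periodicPts_iff_leads.2 (hR _)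
  refine (bijOn_periodicPts g).injOn hyp (Leads.mem_periodicPts ⟨m, rfl⟩ hx) ?_
  rw [hy, hmx]

/-- The Markov chain tree theorem: the tree weights solve the master equation. -/
theorem solvesMasterEq_treeWeight (k : V → V → ℝ) : SolvesMasterEq k (treeWeight k) := by
  intro x
  rw [sum_mul_treeWeight]
  simp only [mul_treeWeight]
  rw [Finset.sum_comm]
  refine Finset.sum_congr rfl fun g _ => ?_
  by_cases h : Rooted g x
  · obtain ⟨y, hy, huniq⟩ := existsUnique_pred_of_rooted h
    rw [if_pos h, Finset.sum_eq_single y, if_pos hy]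
    · exact fun b _ hb => if_neg fun hb' => hb (huniq b hb')
    · exact fun hn => absurd (Finset.mem_univ y) hn
  · rw [if_neg h]
    refine (Finset.sum_eq_zero fun y _ => if_neg ?_).symm
    rintro ⟨hy, hR⟩
    exact h fun v => (hR v).trans ⟨1, hy⟩

end WeightedSums

/-! ### Relaxation of finite Markov semigroups -/

section Semigroup

open Classical Matrix

variable {V : Type*} [Fintype V] {k : V → V → ℝ} {ρ : V → ℝ} {L : Matrix V V ℝ}

section

attribute [local instance] Matrix.linftyOpNormedRing Matrix.linftyOpNormedAlgebra

theorem hasDerivAt_exp_smul_mulVec (L : Matrix V V ℝ) (v : V → ℝ) (x : V) (t : ℝ) :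
    HasDerivAt (fun t : ℝ => (NormedSpace.exp (t • L) *ᵥ v) x)
      ((L *ᵥ (NormedSpace.exp (t • L) *ᵥ v)) x) t := by
  have h : HasDerivAt (fun t : ℝ => NormedSpace.exp (t • L)) (L * NormedSpace.exp (t • L)) t :=
    hasDerivAt_exp_smul_const' L t
  let φ : Matrix V V ℝ →ₗ[ℝ] ℝ :=
    { toFun := fun A => (A *ᵥ v) x
      map_add' := fun A B => by rw [Matrix.add_mulVec, Pi.add_apply]
      map_smul' := fun c A => by rw [Matrix.smul_mulVec, Pi.smul_apply, RingHom.id_apply] }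
  have h2 := (LinearMap.toContinuousLinearMap φ).hasFDerivAt.comp_hasDerivAt t h
  rw [Matrix.mulVec_mulVec]
  exact h2

theorem exp_smul_mulVec_comm (L : Matrix V V ℝ) (v : V → ℝ) (t : ℝ) :
    L *ᵥ (NormedSpace.exp (t • L) *ᵥ v) = NormedSpace.exp (t • L) *ᵥ (L *ᵥ v) := by
  rw [Matrix.mulVec_mulVec, Matrix.mulVec_mulVec]
  congr 1
  exact (((Commute.refl L).smul_right t).exp_right).eq

end

/-! ### Dirichlet form and Poincaré inequality -/

theorem SolvesMasterEq.sum_mul_sum_sub (hρ : SolvesMasterEq k ρ) (f : V → ℝ) :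
    ∑ x, ρ x * ∑ y, k x y * (f y - f x) = 0 := by
  simp only [mul_sub, Finset.sum_sub_distrib, Finset.mul_sum]
  rw [sub_eq_zero, Finset.sum_comm]
  refine Finset.sum_congr rfl fun x _ => ?_
  have := congrArg (fun r => r * f x) (hρ x)
  simp only [Finset.sum_mul] at this
  calc ∑ y, ρ y * (k y x * f x) = ∑ y, k y x * ρ y * f x :=
        Finset.sum_congr rfl fun y _ => by ring
    _ = ∑ y, k x y * ρ x * f x := this.symm
    _ = _ := Finset.sum_congr rfl fun y _ => by ring

/-- The Dirichlet form. -/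
noncomputable def dirichletForm (k : V → V → ℝ) (ρ : V → ℝ) (u : V → ℝ) : ℝ :=
  ∑ x, ∑ y, ρ x * k x y * (u x - u y) ^ 2

/-- The stationary mean of the generator applied to `u ^ 2` is zero; subtracting it completes the
square. -/
theorem SolvesMasterEq.sum_two_mul_mul_generator (hρ : SolvesMasterEq k ρ)
    (u : V → ℝ) :
    ∑ x, ρ x * (2 * u x * ∑ y, k x y * (u y - u x)) = -dirichletForm k ρ u := by
  have := hρ.sum_mul_sum_sub fun x => u x ^ 2
  rw [← sub_zero (∑ x, _), ← this, dirichletForm, ← Finset.sum_sub_distrib,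
    ← Finset.sum_neg_distrib]
  refine Finset.sum_congr rfl fun x _ => ?_
  simp only [Finset.mul_sum]
  rw [← Finset.sum_sub_distrib, ← Finset.sum_neg_distrib]
  exact Finset.sum_congr rfl fun y _ => by ring

theorem dirichletForm_nonneg (hk : ∀ x y, 0 ≤ k x y) (hpos : ∀ x, 0 < ρ x) (u : V → ℝ) :
    0 ≤ dirichletForm k ρ u :=
  Finset.sum_nonneg fun x _ => Finset.sum_nonneg fun y _ =>
    mul_nonneg (mul_nonneg (hpos x).le (hk x y)) (sq_nonneg _)

variable {G : SimpleGraph V}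

theorem exists_sq_sub_le_dirichletForm (hk : ∀ x y, 0 ≤ k x y)
    (hG : ∀ x y, G.Adj x y → 0 < k x y) (hpos : ∀ x, 0 < ρ x) {x y : V} (h : G.Reachable x y) :
    ∃ C, ∀ u : V → ℝ, (u x - u y) ^ 2 ≤ C * dirichletForm k ρ u := by
  obtain ⟨p⟩ := h
  induction p with
  | nil => exact ⟨0, fun u => by simp⟩
  | @cons a b c hab _ ih =>
    obtain ⟨C, hC⟩ := ih
    have hw : 0 < ρ a * k a b := mul_pos (hpos a) (hG a b hab)
    -- The factors 2 come from `(s + t) ^ 2 ≤ 2 * s ^ 2 + 2 * t ^ 2`, splitting off the first step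
    -- of the walk.
    refine ⟨2 * (ρ a * k a b)⁻¹ + 2 * C, fun u => ?_⟩
    have h1 : ρ a * k a b * (u a - u b) ^ 2 ≤ dirichletForm k ρ u := by
      have hnn : ∀ x y, 0 ≤ ρ x * k x y * (u x - u y) ^ 2 := fun x y =>
        mul_nonneg (mul_nonneg (hpos x).le (hk x y)) (sq_nonneg _)
      refine le_trans ?_ (Finset.single_le_sum (fun x _ => Finset.sum_nonneg fun y _ => hnn x y)
        (Finset.mem_univ a))
      exact Finset.single_le_sum (fun y _ => hnn a y) (Finset.mem_univ b)
    have h2 : (u a - u b) ^ 2 ≤ (ρ a * k a b)⁻¹ * dirichletForm k ρ u := by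
      rw [inv_mul_eq_div, le_div_iff₀ hw, mul_comm]
      exact h1
    nlinarith [hC u, sq_nonneg ((u a - u b) - (u b - u c))]

/-- The Poincaré inequality. -/
theorem exists_poincare (hk : ∀ x y, 0 ≤ k x y) (hconn : G.Connected)
    (hG : ∀ x y, G.Adj x y → 0 < k x y) (hpos : ∀ x, 0 < ρ x) :
    ∃ C > 0, ∀ u : V → ℝ, ∑ x, ρ x * u x = 0 →
      ∑ x, ρ x * u x ^ 2 ≤ C * dirichletForm k ρ u := by
  choose C hC using fun x y =>
    exists_sq_sub_le_dirichletForm hk hG hpos (hconn.preconnected x y)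
  have hS : 0 < ∑ x, ρ x :=
    Finset.sum_pos (fun x _ => hpos x) (Finset.univ_nonempty_iff.2 hconn.nonempty)
  -- The chosen `C x y` have no known sign, hence the absolute value; the `+ 1` makes the constant
  -- strictly positive.
  refine ⟨(∑ x, ρ x)⁻¹ * (|∑ x, ∑ y, ρ x * ρ y * C x y| + 1), by positivity, fun u hu => ?_⟩
  have hD := dirichletForm_nonneg hk hpos u
  have h1 : ∑ x, ∑ y, ρ x * ρ y * (u x - u y) ^ 2 = 2 * (∑ x, ρ x) * ∑ x, ρ x * u x ^ 2 := by
    have e : ∀ x y, ρ x * ρ y * (u x - u y) ^ 2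
        = ρ x * u x ^ 2 * ρ y - 2 * (ρ x * u x * (ρ y * u y)) + ρ x * (ρ y * u y ^ 2) :=
      fun x y => by ring
    simp only [e, Finset.sum_add_distrib, Finset.sum_sub_distrib, ← Finset.mul_sum,
      ← Finset.sum_mul]
    rw [hu]
    ring
  have h2 : ∑ x, ∑ y, ρ x * ρ y * (u x - u y) ^ 2
      ≤ (|∑ x, ∑ y, ρ x * ρ y * C x y| + 1) * dirichletForm k ρ u := by
    calc ∑ x, ∑ y, ρ x * ρ y * (u x - u y) ^ 2
        ≤ ∑ x, ∑ y, ρ x * ρ y * (C x y * dirichletForm k ρ u) :=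
          Finset.sum_le_sum fun x _ => Finset.sum_le_sum fun y _ =>
            mul_le_mul_of_nonneg_left (hC x y u) (mul_pos (hpos x) (hpos y)).le
      _ = (∑ x, ∑ y, ρ x * ρ y * C x y) * dirichletForm k ρ u := by
          simp only [Finset.sum_mul]
          exact Finset.sum_congr rfl fun x _ => Finset.sum_congr rfl fun y _ => by ring
      _ ≤ _ := mul_le_mul_of_nonneg_right
          ((le_abs_self _).trans (le_add_of_nonneg_right zero_le_one)) hD
  have h3 : 0 ≤ ∑ x, ρ x * u x ^ 2 :=
    Finset.sum_nonneg fun x _ => mul_nonneg (hpos x).le (sq_nonneg _)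
  rw [mul_assoc, inv_mul_eq_div, le_div_iff₀ hS]
  nlinarith

/-! ### Exponential relaxation and the Poisson equation -/

theorem sum_mul_exp_smul_mulVec (hL : ∀ u x, (L *ᵥ u) x = ∑ y, k x y * (u y - u x))
    (hρ : SolvesMasterEq k ρ) (v : V → ℝ) (t : ℝ) :
    ∑ x, ρ x * (NormedSpace.exp (t • L) *ᵥ v) x = ∑ x, ρ x * v x := by
  have hd : ∀ t, HasDerivAt (fun t : ℝ => ∑ x, ρ x * (NormedSpace.exp (t • L) *ᵥ v) x) 0 t := by
    intro t
    have := HasDerivAt.fun_sum (u := Finset.univ) fun x _ =>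
      (hasDerivAt_exp_smul_mulVec L v x t).const_mul (ρ x)
    simp only [hL] at this
    rwa [hρ.sum_mul_sum_sub] at this
  have := is_const_of_deriv_eq_zero (fun t => (hd t).differentiableAt) (fun t => (hd t).deriv) t 0
  simpa using this

/-- Exponential convergence to the stationary mean. -/
theorem exists_exp_decay (hL : ∀ u x, (L *ᵥ u) x = ∑ y, k x y * (u y - u x))
    (hρ : IsStationaryDist k ρ) (hpos : ∀ x, 0 < ρ x)
    (hk : ∀ x y, 0 ≤ k x y) (hconn : G.Connected) (hG : ∀ x y, G.Adj x y → 0 < k x y)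
    (v : V → ℝ) :
    ∃ γ > 0, ∃ K, ∀ t ≥ 0, ∀ x,
      |(NormedSpace.exp (t • L) *ᵥ v) x - ∑ y, ρ y * v y| ≤ K * Real.exp (-γ * t) := by
  obtain ⟨C, hC, hP⟩ := exists_poincare hk hconn hG hpos
  set m := ∑ y, ρ y * v y with hm
  set u : ℝ → V → ℝ := fun t x => (NormedSpace.exp (t • L) *ᵥ v) x - m with hu
  have hud : ∀ t x, HasDerivAt (fun t => u t x) (∑ y, k x y * (u t y - u t x)) t := by
    intro t x
    have := (hasDerivAt_exp_smul_mulVec L v x t).sub_const m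
    rw [hL] at this
    simpa [hu] using this
  have hu0 : ∀ t, ∑ x, ρ x * u t x = 0 := by
    intro t
    simp only [hu, mul_sub, Finset.sum_sub_distrib, ← Finset.sum_mul, hρ.sum_eq_one,
      sum_mul_exp_smul_mulVec hL hρ.master]
    rw [hm]; ring
  set E : ℝ → ℝ := fun t => ∑ x, ρ x * u t x ^ 2 with hE
  have hEd : ∀ t, HasDerivAt E (-dirichletForm k ρ (u t)) t := by
    intro t
    have := HasDerivAt.fun_sum (u := Finset.univ) fun x _ =>
      ((hud t x).pow 2).const_mul (ρ x)
    rw [← hρ.master.sum_two_mul_mul_generator]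
    simpa using this
  have hFd : ∀ t, HasDerivAt (fun t => E t * Real.exp (C⁻¹ * t))
      (-dirichletForm k ρ (u t) * Real.exp (C⁻¹ * t) +
        E t * (Real.exp (C⁻¹ * t) * C⁻¹)) t := by
    intro t
    have h1 : HasDerivAt (fun t : ℝ => C⁻¹ * t) C⁻¹ t := by
      simpa using (hasDerivAt_id t).const_mul C⁻¹
    exact (hEd t).mul h1.exp
  -- Grönwall: the variance `E` has derivative minus the Dirichlet form, which is at most `-C⁻¹ * E`
  -- by the Poincaré inequality.
  have hanti : Antitone fun t => E t * Real.exp (C⁻¹ * t) := by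
    refine antitone_of_deriv_nonpos (fun t => (hFd t).differentiableAt) fun t => ?_
    rw [(hFd t).deriv]
    have h1 : C⁻¹ * E t ≤ dirichletForm k ρ (u t) := by
      rw [inv_mul_le_iff₀ hC]
      exact hP _ (hu0 t)
    have h2 := Real.exp_pos (C⁻¹ * t)
    nlinarith
  have hEle : ∀ t ≥ 0, E t ≤ E 0 * Real.exp (-(C⁻¹ * t)) := by
    intro t ht
    have := hanti ht
    simp only [mul_zero, Real.exp_zero, mul_one] at this
    rw [Real.exp_neg, ← div_eq_mul_inv, le_div_iff₀ (Real.exp_pos _)]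
    exact this
  -- A square root of the bound on `E` halves the rate; bounding one term of `E` costs the factor `1
  -- / ρ x`.
  refine ⟨C⁻¹ / 2, by positivity, ∑ x, Real.sqrt (E 0 / ρ x), fun t ht x => ?_⟩
  have hE0 : 0 ≤ E 0 := Finset.sum_nonneg fun x _ => mul_nonneg (hpos x).le (sq_nonneg _)
  have h1 : u t x ^ 2 ≤ E 0 / ρ x * Real.exp (-(C⁻¹ / 2) * t) ^ 2 := by
    have hs : ρ x * u t x ^ 2 ≤ E t :=
      Finset.single_le_sum (f := fun x => ρ x * u t x ^ 2)
        (fun x _ => mul_nonneg (hpos x).le (sq_nonneg _)) (Finset.mem_univ x)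
    have he : Real.exp (-(C⁻¹ / 2) * t) ^ 2 = Real.exp (-(C⁻¹ * t)) := by
      rw [← Real.exp_nat_mul]; congr 1; push_cast; ring
    rw [he, div_mul_eq_mul_div, le_div_iff₀ (hpos x), mul_comm]
    exact hs.trans (hEle t ht)
  have h2 : |u t x| ≤ Real.sqrt (E 0 / ρ x) * Real.exp (-(C⁻¹ / 2) * t) := by
    refine abs_le_of_sq_le_sq ?_ (by positivity)
    rw [mul_pow, Real.sq_sqrt (div_nonneg hE0 (hpos x).le)]
    exact h1
  refine h2.trans (mul_le_mul_of_nonneg_right ?_ (Real.exp_pos _).le)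
  exact Finset.single_le_sum (f := fun x => Real.sqrt (E 0 / ρ x))
    (fun x _ => Real.sqrt_nonneg _) (Finset.mem_univ x)

theorem integrableOn_exp_smul_mulVec_sub
    (hL : ∀ u x, (L *ᵥ u) x = ∑ y, k x y * (u y - u x))
    (hρ : IsStationaryDist k ρ) (hpos : ∀ x, 0 < ρ x)
    (hk : ∀ x y, 0 ≤ k x y) (hconn : G.Connected) (hG : ∀ x y, G.Adj x y → 0 < k x y)
    (v : V → ℝ) (x : V) :
    IntegrableOn (fun t : ℝ => (NormedSpace.exp (t • L) *ᵥ v) x - ∑ y, ρ y * v y)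
      (Set.Ioi 0) := by
  obtain ⟨γ, hγ, K, hK⟩ := exists_exp_decay hL hρ hpos hk hconn hG v
  have hi : IntegrableOn (fun t : ℝ => K * Real.exp (-γ * t)) (Set.Ioi 0) :=
    (exp_neg_integrableOn_Ioi 0 hγ).const_mul K
  have hc : Continuous fun t : ℝ => (NormedSpace.exp (t • L) *ᵥ v) x - ∑ y, ρ y * v y :=
    continuous_iff_continuousAt.2 fun t =>
      ((hasDerivAt_exp_smul_mulVec L v x t).sub_const _).continuousAt
  refine Integrable.mono' hi hc.aestronglyMeasurable ?_
  filter_upwards [ae_restrict_mem measurableSet_Ioi] with t ht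
  exact hK t (le_of_lt ht) x

/-- The time integral of the excess solves the Poisson equation. -/
theorem integral_exp_smul_mulVec_sub
    (hL : ∀ u x, (L *ᵥ u) x = ∑ y, k x y * (u y - u x))
    (hρ : IsStationaryDist k ρ) (hpos : ∀ x, 0 < ρ x)
    (hk : ∀ x y, 0 ≤ k x y) (hconn : G.Connected) (hG : ∀ x y, G.Adj x y → 0 < k x y)
    {v h : V → ℝ} (hh0 : ∑ x, ρ x * h x = 0)
    (hh : ∀ x, ∑ y, k x y * (h y - h x) = (∑ y, ρ y * v y) - v x) (x : V) :
    ∫ t in Set.Ioi (0 : ℝ), ((NormedSpace.exp (t • L) *ᵥ v) x - ∑ y, ρ y * v y) = h x := by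
  set m := ∑ y, ρ y * v y with hm
  have hone : ∀ t : ℝ, NormedSpace.exp (t • L) *ᵥ (fun _ => m) = fun _ => m := by
    intro t
    ext x
    have hd : ∀ t, HasDerivAt (fun t : ℝ => (NormedSpace.exp (t • L) *ᵥ fun _ => m) x) 0 t := by
      intro t
      have := hasDerivAt_exp_smul_mulVec L (fun _ => m) x t
      rwa [exp_smul_mulVec_comm, show L *ᵥ (fun _ => m) = 0 by ext x; simp [hL],
        Matrix.mulVec_zero, Pi.zero_apply] at this
    have := is_const_of_deriv_eq_zero (fun t => (hd t).differentiableAt)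
      (fun t => (hd t).deriv) t 0
    simpa using this
  have hLh : L *ᵥ h = (fun _ => m) - v := by
    ext x
    rw [hL, hh, Pi.sub_apply]
  -- An antiderivative of the integrand, because `L h = m - v` and constants are invariant; it
  -- decays since `h` has stationary mean zero.
  have hd : ∀ t, HasDerivAt (fun t : ℝ => -(NormedSpace.exp (t • L) *ᵥ h) x)
      ((NormedSpace.exp (t • L) *ᵥ v) x - m) t := by
    intro t
    have := (hasDerivAt_exp_smul_mulVec L h x t).neg
    rw [exp_smul_mulVec_comm, hLh, Matrix.mulVec_sub, hone, Pi.sub_apply, neg_sub] at this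
    exact this
  have hlim : Tendsto (fun t : ℝ => -(NormedSpace.exp (t • L) *ᵥ h) x) atTop (𝓝 0) := by
    obtain ⟨γ, hγ, K, hK⟩ := exists_exp_decay hL hρ hpos hk hconn hG h
    have h0 : Tendsto (fun t : ℝ => K * Real.exp (-γ * t)) atTop (𝓝 0) := by
      have : Tendsto (fun t : ℝ => -γ * t) atTop atBot :=
        tendsto_id.const_mul_atTop_of_neg (neg_lt_zero.2 hγ)
      simpa using (Real.tendsto_exp_atBot.comp this).const_mul K
    refine squeeze_zero_norm' ?_ h0
    filter_upwards [eventually_ge_atTop 0] with t ht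
    have := hK t ht x
    rw [hh0, sub_zero] at this
    rwa [norm_neg]
  have := integral_Ioi_of_hasDerivAt_of_tendsto' (fun t _ => hd t)
    (integrableOn_exp_smul_mulVec_sub hL hρ hpos hk hconn hG v x) hlim
  rw [this]
  simp

end Semigroup

/-! ### The graph of a self-map -/

section MapGraph

open Classical Function SimpleGraph

variable {V : Type*} {g : V → V} {a b c u v w x y z r : V}

/-- The simple graph with the edges `{v, g v}`. -/
def mapGraph (g : V → V) : SimpleGraph V := SimpleGraph.fromRel fun a b => g a = b

theorem mapGraph_adj : (mapGraph g).Adj a b ↔ a ≠ b ∧ (g a = b ∨ g b = a) :=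
  SimpleGraph.fromRel_adj _ a b

theorem mapGraph_adj_map (h : g a ≠ a) : (mapGraph g).Adj a (g a) :=
  mapGraph_adj.2 ⟨h.symm, Or.inl rfl⟩

theorem exists_eq_of_mem_edgeSet_mapGraph {e : Sym2 V} (h : e ∈ (mapGraph g).edgeSet) :
    ∃ u, g u ≠ u ∧ e = s(u, g u) := by
  induction e with
  | h a b =>
    obtain ⟨hab, rfl | rfl⟩ := mapGraph_adj.1 ((mapGraph g).mem_edgeSet.1 h)
    · exact ⟨a, hab.symm, rfl⟩
    · exact ⟨b, hab, Sym2.eq_swap⟩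

theorem Leads.reachable (h : Leads g a b) : (mapGraph g).Reachable a b := by
  refine h.induction_on (P := fun a => (mapGraph g).Reachable a b) (Reachable.refl b)
    fun u _ _ ih => ?_
  by_cases hu : g u = u
  · rwa [hu] at ih
  · exact (mapGraph_adj_map hu).reachable.trans ih

theorem leads_iff_of_reachable {K : SimpleGraph V}
    (hK : ∀ a b, K.Adj a b → (Leads g a z ↔ Leads g b z)) (h : K.Reachable a b) :
    Leads g a z ↔ Leads g b z := by
  obtain ⟨p⟩ := h
  induction p with
  | nil => rfl
  | cons h _ ih => exact (hK _ _ h).trans ih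

theorem leads_iff_of_reachable_mapGraph (hz : g z = z) (h : (mapGraph g).Reachable a b) :
    Leads g a z ↔ Leads g b z := by
  refine leads_iff_of_reachable (fun a b hab => ?_) h
  obtain ⟨-, rfl | rfl⟩ := mapGraph_adj.1 hab
  · exact (Leads.map_iff_of_fixed hz).symm
  · exact Leads.map_iff_of_fixed hz

/-- Once the edge is deleted, leading to `v` is constant on components; it holds at `v` but not at
`g v`. Hence loops of the graph use only edges of cycles of `g`. -/
theorem isBridge_mapGraph (h : v ∉ periodicPts g) : (mapGraph g).IsBridge s(v, g v) := by
  rw [isBridge_iff]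
  intro hr
  refine h (mem_periodicPts_iff_leads.2 ((leads_iff_of_reachable (z := v) ?_ hr).1
    (Leads.refl g v)))
  intro a b hab
  rw [SimpleGraph.deleteEdges_adj, mapGraph_adj, Set.mem_singleton_iff] at hab
  obtain ⟨⟨-, rfl | rfl⟩, hne⟩ := hab
  · exact (Leads.map_iff fun e => hne (by rw [e])).symm
  · exact Leads.map_iff fun e => hne (by rw [e, Sym2.eq_swap])

theorem exists_mem_periodicPts_of_mem_edges {p : (mapGraph g).Walk a a} (hp : p.IsCycle)
    {e : Sym2 V} (he : e ∈ p.edges) : ∃ u ∈ periodicPts g, g u ≠ u ∧ e = s(u, g u) := by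
  obtain ⟨u, hu, rfl⟩ := exists_eq_of_mem_edgeSet_mapGraph (p.edges_subset_edgeSet he)
  refine ⟨u, ?_, hu, rfl⟩
  by_contra hn
  exact (isBridge_mapGraph hn).notMem_edges_of_isCycle hp he

/-- The graph of a map with a single cycle besides the fixed point `z` has only one loop. -/
theorem edges_eq_of_isCycle_mapGraph (hz : g z = z) (hU : AtMostOneCycle g z)
    (hc : c ∈ periodicPts g) (hcz : c ≠ z) {p : (mapGraph g).Walk a a} (hp : p.IsCycle) :
    {e | e ∈ p.edges} = {e | ∃ u, Leads g c u ∧ e = s(u, g u)} := by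
  ext e
  constructor
  · intro he
    obtain ⟨u, hu, hgu, rfl⟩ := exists_mem_periodicPts_of_mem_edges hp he
    exact ⟨u, hU c hc u hu hcz fun h => hgu (by rw [h, hz]), rfl⟩
  · rintro ⟨u, hu, rfl⟩
    -- A loop missing the edge at `u` would survive when the arrow at `u` is cut, giving `g` a cycle
    -- that avoids `z` and does not lead to `u`.
    by_contra hn
    have hup := hu.mem_periodicPts hc
    have huz : u ≠ z := fun h => hcz (eq_of_leads_of_mem_periodicPts hz hc (h ▸ hu))
    have hq : ∀ e ∈ p.edges, e ∈ (mapGraph (update g u u)).edgeSet := by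
      intro e he
      obtain ⟨b, hb, rfl⟩ := exists_eq_of_mem_edgeSet_mapGraph (p.edges_subset_edgeSet he)
      have hbu : b ≠ u := by
        rintro rfl
        exact hn he
      rw [mem_edgeSet, mapGraph_adj, update_of_ne hbu]
      exact ⟨hb.symm, Or.inl rfl⟩
    have hne : p.edges ≠ [] := fun h => hp.not_nil (Walk.edges_eq_nil.1 h)
    obtain ⟨e, he⟩ := List.exists_mem_of_ne_nil _ hne
    obtain ⟨b, hb, hgb, -⟩ := exists_mem_periodicPts_of_mem_edges (hp.transfer hq)
      (by rw [Walk.edges_transfer]; exact he)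
    have hbu : b ≠ u := by
      rintro rfl
      exact hgb (update_self ..)
    have hbl : ¬ Leads g b u := fun h =>
      hbu (eq_of_leads_of_mem_periodicPts (update_self ..) hb (Leads.update_iff.2 h))
    have hbz : b ≠ z := by
      rintro rfl
      exact hgb (by rw [update_of_ne hbu, hz])
    exact hbl (hU b ((mem_periodicPts_update_of_not_leads hbl).1 hb) u hup hbz huz)

theorem exists_walk_iterate (n : ℕ) (h : ∀ i < n, g^[i + 1] a ≠ g^[i] a) (hb : g^[n] a = b) :
    ∃ p : (mapGraph g).Walk a b, p.support = (List.range (n + 1)).map (fun i => g^[i] a) ∧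
      ∀ e, (∃ d ∈ p.darts, d.toProd = e) ↔ ∃ i < n, e = (g^[i] a, g^[i + 1] a) := by
  induction n generalizing a with
  | zero =>
    obtain rfl : a = b := hb
    exact ⟨Walk.nil, by simp, by simp⟩
  | succ n ih =>
    obtain ⟨p, hs, hd⟩ := ih (fun i hi => h (i + 1) (by omega)) hb
    refine ⟨Walk.cons (mapGraph_adj_map (h 0 n.succ_pos)) p, ?_, fun e => ?_⟩
    · rw [Walk.support_cons, hs, List.range_succ_eq_map (n := n + 1), List.map_cons, List.map_map]
      rfl
    · simp only [Walk.darts_cons, List.mem_cons, exists_eq_or_imp, hd]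
      constructor
      · rintro (rfl | ⟨i, hi, rfl⟩)
        · exact ⟨0, n.succ_pos, rfl⟩
        · exact ⟨i + 1, by omega, rfl⟩
      · rintro ⟨i, hi, rfl⟩
        cases i with
        | zero => exact Or.inl rfl
        | succ i => exact Or.inr ⟨i, by omega, rfl⟩

theorem leads_iff_exists_lt (hc : c ∈ periodicPts g) :
    Leads g c u ↔ ∃ i < minimalPeriod g c, g^[i] c = u := by
  constructor
  · rintro ⟨n, rfl⟩
    exact ⟨n % minimalPeriod g c, Nat.mod_lt _ (minimalPeriod_pos_of_mem_periodicPts hc),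
      iterate_mod_minimalPeriod_eq⟩
  · rintro ⟨i, -, h⟩
    exact ⟨i, h⟩

/-- A cycle of length at least three of `g` is a loop of the graph of `g`. -/
theorem exists_isCycle_mapGraph (hc : c ∈ periodicPts g) (h3 : 3 ≤ minimalPeriod g c) :
    ∃ p : (mapGraph g).Walk c c, p.IsCycle ∧ (∀ u, u ∈ p.support ↔ Leads g c u) ∧
      ∀ e, (∃ d ∈ p.darts, d.toProd = e) ↔ Leads g c e.1 ∧ e.2 = g e.1 := by
  obtain ⟨m, hm⟩ : ∃ m, minimalPeriod g c = m + 1 := ⟨_, (Nat.sub_add_cancel (by omega)).symm⟩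
  have hinj : ∀ i ≤ m, ∀ j ≤ m, g^[i] c = g^[j] c → i = j := fun i hi j hj h =>
    iterate_injOn_Iio_minimalPeriod (show i < _ by omega) (show j < _ by omega) h
  have hend : g^[m + 1] c = c := by rw [← hm, iterate_minimalPeriod]
  have hne : ∀ i ≤ m, g^[i + 1] c ≠ g^[i] c := by
    intro i hi h
    rcases hi.lt_or_eq with hi | rfl
    · have := hinj _ hi _ hi.le h
      omega
    · rw [hend] at h
      have := hinj 0 (by omega) i le_rfl h
      omega
  obtain ⟨p, hs, hd⟩ := exists_walk_iterate (a := g c) (b := c) m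
    (fun i hi => hne (i + 1) hi) hend
  have hgc : (mapGraph g).Adj c (g c) := mapGraph_adj_map (hne 0 (Nat.zero_le m))
  refine ⟨Walk.cons hgc p, (Walk.cons_isCycle_iff p hgc).2 ⟨?_, ?_⟩, fun u => ?_, fun e => ?_⟩
  · rw [Walk.isPath_def, hs, List.nodup_map_iff_inj_on List.nodup_range]
    intro i hi j hj hij
    rw [List.mem_range] at hi hj
    change g^[i + 1] c = g^[j + 1] c at hij
    rcases (Nat.le_of_lt_succ hi).lt_or_eq with hi | rfl <;>
      rcases (Nat.le_of_lt_succ hj).lt_or_eq with hj | rfl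
    · have := hinj _ hi _ hj hij
      omega
    · rw [hend] at hij
      have := hinj _ hi 0 (by omega) hij
      omega
    · rw [hend] at hij
      have := hinj 0 (by omega) _ hj hij
      omega
    · rfl
  -- The closing edge can recur only if `g^[2] c = c`, which `h3` excludes.
  · intro he
    rw [Walk.edges, List.mem_map] at he
    obtain ⟨d, hdp, hde⟩ := he
    obtain ⟨i, hi, hi'⟩ := (hd d.toProd).1 ⟨d, hdp, rfl⟩
    rw [Dart.edge, hi'] at hde
    change s(g^[i + 1] c, g^[i + 2] c) = s(c, g c) at hde
    rw [Sym2.eq_iff] at hde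
    rcases hde with ⟨h, -⟩ | ⟨h1, h2⟩
    · have := hinj (i + 1) hi 0 (by omega) h
      omega
    · have h1' := hinj (i + 1) hi 1 (by omega) h1
      obtain rfl : i = 0 := by omega
      have := hinj 2 (by omega) 0 (by omega) h2
      omega
  · rw [leads_iff_exists_lt hc, Walk.support_cons, hs, List.mem_cons, List.mem_map, hm]
    constructor
    · rintro (rfl | ⟨i, hi, rfl⟩)
      · exact ⟨0, m.succ_pos, rfl⟩
      · rw [List.mem_range] at hi
        rcases (Nat.le_of_lt_succ hi).lt_or_eq with hi | rfl
        · exact ⟨i + 1, by omega, rfl⟩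
        · exact ⟨0, by omega, hend.symm⟩
    · rintro ⟨i, hi, rfl⟩
      cases i with
      | zero => exact Or.inl rfl
      | succ i => exact Or.inr ⟨i, List.mem_range.2 (by omega), rfl⟩
  · rw [leads_iff_exists_lt hc, hm]
    simp only [Walk.darts_cons, List.mem_cons, exists_eq_or_imp, hd]
    constructor
    · rintro (rfl | ⟨i, hi, rfl⟩)
      · exact ⟨⟨0, m.succ_pos, rfl⟩, rfl⟩
      · exact ⟨⟨i + 1, by omega, rfl⟩, iterate_succ_apply' g i (g c)⟩
    · obtain ⟨e1, e2⟩ := e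
      rintro ⟨⟨i, hi, rfl⟩, h2⟩
      cases i with
      | zero => exact Or.inl (Prod.ext rfl h2.symm)
      | succ i =>
        exact Or.inr ⟨i, by omega, Prod.ext rfl (h2.trans (iterate_succ_apply' g (i + 1) c).symm)⟩

/-- A path of the graph of `g` that starts against the direction of `g` continues so. -/
theorem leads_of_isPath (h : (mapGraph g).Adj u v) (p : (mapGraph g).Walk v r)
    (hp : (Walk.cons h p).IsPath) (hv : g v = u) : Leads g r v := by
  induction p generalizing u with
  | nil => exact Leads.refl g _
  | @cons v w r h' p ih =>
    have hvw := (mapGraph_adj.1 h').2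
    have hw : g w = v := by
      -- Following the arrow out of `v` would return to `u`, already visited by the path.
      refine hvw.resolve_left fun e => ?_
      rw [Walk.cons_isPath_iff] at hp
      apply hp.2
      rw [← hv, e, Walk.support_cons]
      exact List.mem_cons_of_mem _ p.start_mem_support
    exact (ih h' hp.of_cons hw).trans ⟨1, hw⟩

theorem orientedTreeLoopTree_mapGraph [Fintype V] (hz : g z = z) (hg : ∀ v, v ≠ z → g v ≠ v)
    (hU : AtMostOneCycle g z) (hc : c ∈ periodicPts g) (hcz : c ≠ z)
    (p : (mapGraph g).Walk c c) (hs : ∀ u, u ∈ p.support ↔ Leads g c u)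
    (hd : ∀ e, (∃ d ∈ p.darts, d.toProd = e) ↔ Leads g c e.1 ∧ e.2 = g e.1) :
    orientedTreeLoopTree (mapGraph g) p z =
      Finset.univ.filter fun e : V × V => e.1 ≠ z ∧ e.2 = g e.1 := by
  have hE : ∀ e, e ∈ p.edges ↔ ∃ w, Leads g c w ∧ e = s(w, g w) := by
    intro e
    rw [Walk.edges, List.mem_map]
    constructor
    · rintro ⟨d, hdp, rfl⟩
      obtain ⟨h1, h2⟩ := (hd d.toProd).1 ⟨d, hdp, rfl⟩
      refine ⟨_, h1, ?_⟩
      rw [← h2]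
      rfl
    · rintro ⟨w, hw, rfl⟩
      obtain ⟨d, hdp, hdw⟩ := (hd (w, g w)).2 ⟨hw, rfl⟩
      refine ⟨d, hdp, ?_⟩
      rw [Dart.edge, hdw]
  have hcl : ∀ w, Leads g c w → w ≠ z := fun w hw h =>
    hcz (eq_of_leads_of_mem_periodicPts hz hc (h ▸ hw))
  ext ⟨u, v⟩
  simp only [orientedTreeLoopTree, Finset.mem_filter, Finset.mem_univ, true_and, hd, hE]
  constructor
  · rintro (⟨h1, h2⟩ | ⟨hn, r, hr, h, q, hq⟩)
    · exact ⟨hcl u h1, h2⟩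
    · obtain ⟨huv, hgu | hgv⟩ := mapGraph_adj.1 h
      · refine ⟨?_, hgu.symm⟩
        rintro rfl
        exact huv (hz.symm.trans hgu)
      · exfalso
        -- An edge traversed against `g` forces the end `r` to lead back to `v`: for `r` on the loop
        -- the edge lies on the loop, and for `r = z` the root would have an outgoing edge.
        have hrv := leads_of_isPath h q hq hgv
        rcases hr with hr | rfl
        · rw [Set.mem_ofPred_eq, hs] at hr
          exact hn ⟨v, hr.trans hrv, by rw [hgv, Sym2.eq_swap]⟩
        · have := hrv.eq_of_fixed hz
          rw [this, hz] at hgv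
          exact huv (by rw [this, hgv])
  · rintro ⟨huz, rfl⟩
    by_cases hcu : Leads g c u
    · exact Or.inl ⟨hcu, rfl⟩
    refine Or.inr ⟨?_, ?_⟩
    · rintro ⟨w, hw, he⟩
      rcases Sym2.eq_iff.1 he with ⟨h, -⟩ | ⟨h, -⟩
      · exact hcu (h ▸ hw)
      · exact hcu (h ▸ hw.trans (Leads.step g w))
    · have hmem : ∀ r ∈ periodicPts g, r ∈ ({u | u ∈ p.support} ∪ {z} : Set V) := by
        intro r hr
        by_cases hrz : r = z
        · exact Or.inr hrz
        · exact Or.inl ((hs r).2 (hU c hc r hr hcz hrz))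
      have hunot : u ∉ periodicPts g := fun h => hcu (hU c hc u h hcz huz)
      obtain ⟨r, hr, hur⟩ := exists_leads_mem_periodicPts g u
      -- The first step of this path is the arrow of `g`; otherwise `r` would lead back to `u`,
      -- making `u` periodic.
      obtain ⟨P, hP⟩ := hur.reachable.exists_isPath
      cases P with
      | nil => exact absurd hr hunot
      | @cons _ v _ h q =>
        obtain ⟨-, hgu | hgv⟩ := mapGraph_adj.1 h
        · subst hgu
          exact ⟨r, hmem r hr, h, q, hP⟩
        · exact absurd ((Leads.trans (leads_of_isPath h q hP hgv) ⟨1, hgv⟩).mem_periodicPts hr) hunot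

/-- A map with one cycle, carrying a nonzero heat, and a root `z`, such that the edge `{x, y}`
joins the component of the cycle with the tree of `z`, is an oriented tree-loop-tree. -/
theorem mem_orientedTreeLoopTrees [Fintype V] {G : SimpleGraph V} {q : V → V → ℝ}
    (hq : ∀ a b, q a b = -q b a) (hz : g z = z) (hadj : ∀ v, v ≠ z → G.Adj v (g v))
    (hxy : G.Adj x y) (hU : AtMostOneCycle g z) (hx : ¬ Leads g x z) (hy : Leads g y z)
    (hne : cycleSum q g ≠ 0) :
    (Finset.univ.filter fun e : V × V => e.1 ≠ z ∧ e.2 = g e.1) ∈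
      orientedTreeLoopTrees G s(x, y) := by
  have hg : ∀ v, v ≠ z → g v ≠ v := fun v hv => (hadj v hv).ne'
  obtain ⟨c, hc, hxc⟩ := exists_leads_mem_periodicPts g x
  have hcz : c ≠ z := fun h => hx (h ▸ hxc)
  have hq0 : ∀ v, q v v = 0 := fun v => by have := hq v v; linarith
  -- Fixed points other than `z` are excluded by adjacency, and a two-cycle has heat zero by
  -- antisymmetry.
  have h3 : 3 ≤ minimalPeriod g c := by
    by_contra hlt
    have hpos := minimalPeriod_pos_of_mem_periodicPts hc
    have hend := iterate_minimalPeriod (f := g) (x := c)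
    rw [cycleSum_eq_sum_range hq0 hz hc hcz hU] at hne
    obtain h | h : minimalPeriod g c = 1 ∨ minimalPeriod g c = 2 := by omega
    · rw [h] at hend
      exact hg c hcz hend
    · rw [h] at hend hne
      rw [Finset.sum_range_succ, Finset.sum_range_one, hend] at hne
      refine hne ?_
      show q c (g c) + q (g c) c = 0
      rw [hq c]
      ring
  obtain ⟨p, hp, hs, hd⟩ := exists_isCycle_mapGraph hc h3
  have hnr : ¬ (mapGraph g).Reachable x y := fun h =>
    hx ((leads_iff_of_reachable_mapGraph hz h).2 hy)
  have hle : mapGraph g ≤ G := by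
    intro a b hab
    obtain ⟨hab, rfl | rfl⟩ := mapGraph_adj.1 hab
    · exact hadj a fun h => hab (by rw [h, hz])
    · exact (hadj b fun h => hab (by rw [h, hz])).symm
  -- The edge joins the component of the cycle to the tree of `z` as a bridge, so it connects the
  -- graph without creating a loop.
  set H := mapGraph g ⊔ SimpleGraph.edge x y with hH
  have hKH : mapGraph g ≤ H := le_sup_left
  have hHxy : H.Adj x y := Or.inr (by simp [SimpleGraph.edge_adj, hxy.ne])
  have hbridge : H.IsBridge s(x, y) :=
    SimpleGraph.isBridge_sup_edge.2 (IsBridge.of_not_reachable hnr)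
  have hHK : ∀ e ∈ H.edgeSet, e ≠ s(x, y) → e ∈ (mapGraph g).edgeSet := by
    intro e he hne
    induction e with
    | h a b =>
      rcases he with he | he
      · exact he
      · rw [SimpleGraph.edge_adj] at he
        exact absurd (Sym2.eq_iff.2 he.1) (fun h => hne (by simpa [eq_comm] using h))
  have hdel : mapGraph g = H.deleteEdges {s(x, y)} := by
    ext a b
    rw [SimpleGraph.deleteEdges_adj, Set.mem_singleton_iff]
    constructor
    · intro h
      refine ⟨hKH h, fun he => hnr ?_⟩
      have : (mapGraph g).Adj x y := by rw [← mem_edgeSet, ← he]; exact h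
      exact this.reachable
    · rintro ⟨h, hne⟩
      exact hHK s(a, b) h hne
  have hloop : ∀ C, IsLoop H C → C = {e | ∃ u, Leads g c u ∧ e = s(u, g u)} := by
    rintro C ⟨v, w, hw, rfl⟩
    have hwe : ∀ e ∈ w.edges, e ∈ (mapGraph g).edgeSet := fun e he =>
      hHK e (w.edges_subset_edgeSet he) fun h => hbridge.notMem_edges_of_isCycle hw (h ▸ he)
    rw [← edges_eq_of_isCycle_mapGraph hz hU hc hcz (hw.transfer hwe), Walk.edges_transfer]
  have hconn : H.Connected := by
    have hcz' : H.Reachable c z :=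
      ((hxc.reachable.mono hKH).symm.trans hHxy.reachable).trans (hy.reachable.mono hKH)
    have hall : ∀ v, H.Reachable v z := by
      intro v
      obtain ⟨b, hb, hvb⟩ := exists_leads_mem_periodicPts g v
      refine (hvb.reachable.mono hKH).trans ?_
      by_cases hbz : b = z
      · rw [hbz]
      · exact ((hU b hb c hc hbz hcz).reachable.mono hKH).trans hcz'
    exact (connected_iff_exists_forall_reachable H).2 ⟨z, fun v => (hall v).symm⟩
  refine ⟨mapGraph g, ⟨H, ⟨⟨sup_le hle ?_, hconn, _, ⟨c, p.mapLe hKH, hp.mapLe hKH, rfl⟩, ?_⟩,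
    hHxy, ?_⟩, hdel⟩, c, p, z, hp, ?_, ?_⟩
  · intro a b hab
    rw [SimpleGraph.edge_adj] at hab
    obtain ⟨⟨rfl, rfl⟩ | ⟨rfl, rfl⟩, -⟩ := hab
    · exact hxy
    · exact hxy.symm
  · intro C hC
    rw [hloop C hC, hloop _ ⟨c, p.mapLe hKH, hp.mapLe hKH, rfl⟩]
  · rintro C ⟨v, w, hw, rfl⟩
    exact hbridge.notMem_edges_of_isCycle hw
  · exact fun h => hcz (eq_of_leads_of_mem_periodicPts hz hc
      ((leads_iff_of_reachable_mapGraph hz h).2 (Leads.refl g z)))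
  · exact (orientedTreeLoopTree_mapGraph hz hg hU hc hcz p hs hd).symm

end MapGraph

/-! ### Spanning trees and bounds on the weights -/

section Bounds

open Classical Function SimpleGraph

variable {V : Type*} [Fintype V] {g : V → V} {x y z : V} {k q φ : V → V → ℝ} {G : SimpleGraph V}

/-- The oriented edges of the map `g` with root `z`. -/
noncomputable def mapEdges (g : V → V) (z : V) : Finset (V × V) :=
  Finset.univ.filter fun e => e.1 ≠ z ∧ e.2 = g e.1

theorem sum_mapEdges (f : V → V → ℝ) :
    ∑ e ∈ mapEdges g z, f e.1 e.2 = ∑ v ∈ Finset.univ.erase z, f v (g v) := by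
  symm
  refine Finset.sum_nbij' (fun v => (v, g v)) Prod.fst ?_ ?_ ?_ ?_ ?_
  · intro v hv; simpa [mapEdges] using hv
  · intro e he
    simpa using (Finset.mem_filter.1 he).2.1
  · intro v _; rfl
  · intro e he
    exact Prod.ext rfl (Finset.mem_filter.1 he).2.2.symm
  · intro v _; rfl

/-- Each vertex other than `z` is sent to the second vertex of its unique path to `z`. -/
theorem exists_rooted_of_isTree {T : SimpleGraph V} (hT : T.IsTree) (z : V) :
    ∃ g : V → V, g z = z ∧ Rooted g z ∧ (∀ v, v ≠ z → T.Adj v (g v)) ∧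
      rootedTree T z = mapEdges g z := by
  have huniq : ∀ {u v w : V} (h : T.Adj u v) (p : T.Walk v z) (h' : T.Adj u w) (p' : T.Walk w z),
      (Walk.cons h p).IsPath → (Walk.cons h' p').IsPath → v = w := by
    intro u v w h p h' p' hp hp'
    have := (hT.existsUnique_path u z).unique hp hp'
    have := congrArg Walk.snd this
    simpa using this
  have hex : ∀ v, ∃ w, (v = z → w = z) ∧
      (v ≠ z → ∃ (h : T.Adj v w) (p : T.Walk w z), (Walk.cons h p).IsPath) := by
    intro v
    by_cases hv : v = z
    · exact ⟨z, fun _ => rfl, fun h => absurd hv h⟩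
    · obtain ⟨P, hP⟩ := (hT.connected.preconnected v z).exists_isPath
      cases P with
      | nil => exact absurd rfl hv
      | @cons _ w _ h p => exact ⟨w, fun h => absurd h hv, fun _ => ⟨h, p, hP⟩⟩
  choose g hgz hg using hex
  have hne : ∀ {u v : V} (h : T.Adj u v) (p : T.Walk v z), (Walk.cons h p).IsPath → u ≠ z := by
    rintro u v h p hp rfl
    rw [Walk.cons_isPath_iff] at hp
    exact hp.2 p.end_mem_support
  have hg' : ∀ {u v : V} (h : T.Adj u v) (p : T.Walk v z), (Walk.cons h p).IsPath → v = g u := by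
    intro u v h p hp
    obtain ⟨h', p', hp'⟩ := hg u (hne h p hp)
    exact huniq h p h' p' hp hp'
  have hR : ∀ {v w : V} (P : T.Walk v w), w = z → P.IsPath → Leads g v z := by
    intro v w P
    induction P with
    | nil =>
      rintro rfl _
      exact Leads.refl g _
    | cons h p ih =>
      rintro rfl hP
      have := ih rfl hP.of_cons
      rw [hg' h p hP] at this
      exact this.of_map
  refine ⟨g, hgz z rfl, fun v => ?_, fun v hv => (hg v hv).1, ?_⟩
  · obtain ⟨P, hP⟩ := (hT.connected.preconnected v z).exists_isPath
    exact hR P rfl hP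
  · ext ⟨u, v⟩
    simp only [rootedTree, mapEdges, Finset.mem_filter, Finset.mem_univ, true_and]
    constructor
    · rintro ⟨r, rfl, h, p, hp⟩
      exact ⟨hne h p hp, hg' h p hp⟩
    · rintro ⟨hu, rfl⟩
      obtain ⟨h, p, hp⟩ := hg u hu
      exact ⟨z, rfl, h, p, hp⟩

/-! ### Estimates of weights and heat numerators -/

theorem rootedWeight_le_treeWeight (hk : ∀ x y, 0 ≤ k x y) (hz : g z = z) (hR : Rooted g z) :
    rootedWeight k z g ≤ treeWeight k z := by
  refine (if_pos hR).symm.le.trans (Finset.single_le_sum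
    (f := fun g => if Rooted g z then rootedWeight k z g else 0) (fun g _ => ?_)
    (Finset.mem_filter.2 ⟨Finset.mem_univ g, hz⟩))
  split_ifs
  exacts [rootedWeight_nonneg hk z g, le_rfl]

theorem treeWeight_pos (hk : ∀ x y, 0 ≤ k x y) (hG : ∀ x y, G.Adj x y → 0 < k x y)
    (hconn : G.Connected) (z : V) : 0 < treeWeight k z := by
  obtain ⟨T, hTG, hT⟩ := hconn.exists_isTree_le
  obtain ⟨g, hz, hR, hadj, -⟩ := exists_rooted_of_isTree hT z
  refine lt_of_lt_of_le ?_ (rootedWeight_le_treeWeight hk hz hR)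
  exact Finset.prod_pos fun v hv => hG _ _ (hTG (hadj v (Finset.ne_of_mem_erase hv)))

theorem prod_mul_exp (c β : ℝ) (φ : V → V → ℝ) (g : V → V) (z : V) :
    ∏ v ∈ Finset.univ.erase z, c * Real.exp (β * φ v (g v))
      = c ^ (Fintype.card V - 1) * Real.exp (β * ∑ e ∈ mapEdges g z, φ e.1 e.2) := by
  rw [Finset.prod_mul_distrib, Finset.prod_const, Finset.card_erase_of_mem (Finset.mem_univ z),
    Finset.card_univ, ← Real.exp_sum, sum_mapEdges, Finset.mul_sum]

theorem le_rootedWeight {c β : ℝ} (hc : 0 ≤ c) (hadj : ∀ v, v ≠ z → G.Adj v (g v))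
    (h : ∀ x y, G.Adj x y → c * Real.exp (β * φ x y) ≤ k x y) :
    c ^ (Fintype.card V - 1) * Real.exp (β * ∑ e ∈ mapEdges g z, φ e.1 e.2)
      ≤ rootedWeight k z g := by
  rw [← prod_mul_exp]
  exact Finset.prod_le_prod (fun v _ => mul_nonneg hc (Real.exp_pos _).le)
    fun v hv => h _ _ (hadj v (Finset.ne_of_mem_erase hv))

theorem rootedWeight_le {C β : ℝ} (hk : ∀ x y, 0 ≤ k x y)
    (hadj : ∀ v, v ≠ z → G.Adj v (g v))
    (h : ∀ x y, G.Adj x y → k x y ≤ C * Real.exp (β * φ x y)) :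
    rootedWeight k z g
      ≤ C ^ (Fintype.card V - 1) * Real.exp (β * ∑ e ∈ mapEdges g z, φ e.1 e.2) := by
  rw [← prod_mul_exp]
  exact Finset.prod_le_prod (fun v _ => hk _ _)
    fun v hv => h _ _ (hadj v (Finset.ne_of_mem_erase hv))

theorem abs_sum_filter_le {Q : ℝ} (hQ : ∀ x y, |q x y| ≤ Q) (g : V → V) (s : Finset V) :
    |∑ u ∈ s, q u (g u)| ≤ Fintype.card V * Q := by
  rcases isEmpty_or_nonempty V with h | ⟨⟨v⟩⟩
  · simp [Finset.eq_empty_of_isEmpty s]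
  have hQ0 : 0 ≤ Q := (abs_nonneg _).trans (hQ v v)
  calc |∑ u ∈ s, q u (g u)| ≤ ∑ u ∈ s, |q u (g u)| := Finset.abs_sum_le_sum_abs _ _
    _ ≤ ∑ _u ∈ s, Q := Finset.sum_le_sum fun u _ => hQ _ _
    _ = s.card * Q := by rw [Finset.sum_const, nsmul_eq_mul]
    _ ≤ Fintype.card V * Q := by
        gcongr
        exact Finset.card_le_univ s

/-- The bound on the contribution of a single map to a difference of heat numerators. -/
theorem abs_rootedWeight_mul_sub_le {Q A W : ℝ} (hk : ∀ x y, 0 ≤ k x y)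
    (hk0 : ∀ x y, ¬ G.Adj x y → k x y = 0) (hq : ∀ a b, q a b = -q b a)
    (hQ : ∀ x y, |q x y| ≤ Q) (hA : 0 ≤ A) (hW : treeWeight k z ≤ W) (hW0 : 0 ≤ W)
    (hD : ∀ g : V → V, (∀ v, v ≠ z → G.Adj v (g v)) →
      mapEdges g z ∈ orientedTreeLoopTrees G s(x, y) → rootedWeight k z g ≤ A * W)
    (hxy : G.Adj x y) (hz : g z = z) :
    |rootedWeight k z g * (heatTo q z g x - heatTo q z g y)|
      ≤ (2 + A) * (Fintype.card V * Q) * W := by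
  have hQ0 : 0 ≤ Q := (abs_nonneg _).trans (hQ x x)
  set N : ℝ := Fintype.card V * Q with hN
  have hN0 : 0 ≤ N := by positivity
  have hnn : 0 ≤ (2 + A) * N * W := by positivity
  have hw := rootedWeight_nonneg hk z g
  by_cases hadj : ∀ v, v ≠ z → G.Adj v (g v)
  swap
  · push Not at hadj
    obtain ⟨v, hv, hvg⟩ := hadj
    have : rootedWeight k z g = 0 :=
      Finset.prod_eq_zero (Finset.mem_erase.2 ⟨hv, Finset.mem_univ v⟩) (hk0 _ _ hvg)
    rw [this, zero_mul, abs_zero]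
    exact hnn
  rw [abs_mul, abs_of_nonneg hw]
  by_cases hR : Rooted g z
  · have h1 : rootedWeight k z g ≤ W := (rootedWeight_le_treeWeight hk hz hR).trans hW
    have h2 : |heatTo q z g x - heatTo q z g y| ≤ 2 * N := by
      simp only [heatTo, if_pos hR]
      refine (abs_sub _ _).trans ?_
      have := abs_sum_filter_le hQ g (Finset.univ.filter fun u => Leads g x u)
      have := abs_sum_filter_le hQ g (Finset.univ.filter fun u => Leads g y u)
      simp only [orbitSum]
      linarith
    calc _ ≤ W * (2 * N) := mul_le_mul h1 h2 (abs_nonneg _) hW0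
      _ ≤ _ := by nlinarith [mul_nonneg (mul_nonneg hA hN0) hW0]
  by_cases hU : AtMostOneCycle g z
  swap
  · simp only [heatTo, if_neg hR, hU, false_and, if_false, sub_zero, abs_zero, mul_zero]
    exact hnn
  by_cases hC : cycleSum q g = 0
  · simp only [heatTo, if_neg hR, hC, ite_self, sub_zero, abs_zero, mul_zero]
    exact hnn
  have hCN : |cycleSum q g| ≤ N := abs_sum_filter_le hQ g _
  have key : rootedWeight k z g ≤ A * W → rootedWeight k z g * |cycleSum q g| ≤ (2 + A) * N * W :=
    fun h => calc _ ≤ A * W * N := mul_le_mul h hCN (abs_nonneg _) (mul_nonneg hA hW0)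
      _ ≤ _ := by nlinarith [mul_nonneg hN0 hW0]
  -- The heats differ only if exactly one endpoint leads to the cycle; then the map is a
  -- tree-loop-tree for the edge and `hD` bounds its weight.
  by_cases hx : Leads g x z <;> by_cases hy : Leads g y z
  · simpa [heatTo, hR, hU, hx, hy] using hnn
  · have := hD g hadj (by
      rw [Sym2.eq_swap]
      exact mem_orientedTreeLoopTrees hq hz hadj hxy.symm hU hy hx hC)
    simpa [heatTo, hR, hU, hx, hy] using key this
  · have := hD g hadj (mem_orientedTreeLoopTrees hq hz hadj hxy hU hx hy hC)
    simpa [heatTo, hR, hU, hx, hy] using key this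
  · simpa [heatTo, hR, hU, hx, hy] using hnn

theorem abs_sum_heatNumerator_sub_le {Q A : ℝ} (hk : ∀ x y, 0 ≤ k x y)
    (hk0 : ∀ x y, ¬ G.Adj x y → k x y = 0) (hq : ∀ a b, q a b = -q b a)
    (hQ : ∀ x y, |q x y| ≤ Q) (hA : 0 ≤ A)
    (hD : ∀ (z : V) (g : V → V), (∀ v, v ≠ z → G.Adj v (g v)) →
      mapEdges g z ∈ orientedTreeLoopTrees G s(x, y) →
      rootedWeight k z g ≤ A * ∑ z, treeWeight k z)
    (hnn : ∀ z, 0 ≤ treeWeight k z)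
    (hxy : G.Adj x y) :
    |∑ z, heatNumerator k q z x - ∑ z, heatNumerator k q z y|
      ≤ Fintype.card V * (Fintype.card (V → V) * ((2 + A) * (Fintype.card V * Q)))
        * ∑ z, treeWeight k z := by
  have hQ0 : 0 ≤ Q := (abs_nonneg _).trans (hQ x x)
  have hW0 : 0 ≤ ∑ z, treeWeight k z := Finset.sum_nonneg fun z _ => hnn z
  set W := ∑ z, treeWeight k z with hW
  have hz : ∀ z, |heatNumerator k q z x - heatNumerator k q z y|
      ≤ Fintype.card (V → V) * ((2 + A) * (Fintype.card V * Q) * W) := by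
    intro z
    rw [heatNumerator, heatNumerator, ← Finset.sum_sub_distrib]
    refine (Finset.abs_sum_le_sum_abs _ _).trans ?_
    refine (Finset.sum_le_card_nsmul _ _ ((2 + A) * (Fintype.card V * Q) * W) fun g hg => ?_).trans ?_
    · rw [← mul_sub]
      exact abs_rootedWeight_mul_sub_le hk hk0 hq hQ hA
        (Finset.single_le_sum (fun z _ => hnn z) (Finset.mem_univ z)) hW0 (hD z) hxy
        (Finset.mem_filter.1 hg).2
    · rw [nsmul_eq_mul]
      gcongr
      exact Finset.card_le_univ _
  rw [← Finset.sum_sub_distrib]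
  refine (Finset.abs_sum_le_sum_abs _ _).trans ?_
  refine (Finset.sum_le_card_nsmul _ _ _ fun z _ => hz z).trans ?_
  rw [nsmul_eq_mul, Finset.card_univ]
  exact le_of_eq (by ring)

/-- The Poisson equation for the sum of the heat numerators. -/
theorem sum_mul_sum_heatNumerator_sub (hq : ∀ v, q v v = 0) (hpos : ∀ z, 0 < treeWeight k z)
    (x : V) :
    ∑ y, k x y * (∑ z, heatNumerator k q z y - ∑ z, heatNumerator k q z x)
      = ∑ z, treeWeight k z * ∑ y, k z y * q z y
        - (∑ z, treeWeight k z) * ∑ y, k x y * q x y := by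
  set w := treeWeight k with hw
  set P : V → ℝ := fun x => ∑ y, k x y * q x y with hP
  have hoff : ∀ z x, x ≠ z →
      ∑ y, k x y * (heatNumerator k q z y - heatNumerator k q z x) = -(w z * P x) := by
    intro z x hxz
    rw [hw, hP, ← sum_mul_heatNumerator_sub hq hxz, ← Finset.sum_neg_distrib]
    exact Finset.sum_congr rfl fun y _ => by ring
  -- The backward equation says nothing at the target itself; the missing value is forced by
  -- stationarity, since the tree weights annihilate the image of the generator.
  have hdiag : ∀ z, ∑ y, k z y * (heatNumerator k q z y - heatNumerator k q z z)
      = ∑ x, w x * P x - w z * P z := by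
    intro z
    have h := (solvesMasterEq_treeWeight k).sum_mul_sum_sub (heatNumerator k q z)
    rw [← Finset.add_sum_erase _ _ (Finset.mem_univ z)] at h
    have h2 : ∑ x ∈ Finset.univ.erase z, treeWeight k x *
        ∑ y, k x y * (heatNumerator k q z y - heatNumerator k q z x)
        = -(w z * ∑ x ∈ Finset.univ.erase z, w x * P x) := by
      rw [Finset.mul_sum, ← Finset.sum_neg_distrib]
      refine Finset.sum_congr rfl fun x hx => ?_
      rw [hoff z x (Finset.ne_of_mem_erase hx)]
      ring
    rw [h2, ← sub_eq_add_neg, ← hw, ← mul_sub] at h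
    have h3 := (mul_eq_zero.1 h).resolve_left (hpos z).ne'
    have h4 := Finset.add_sum_erase _ (fun x => w x * P x) (Finset.mem_univ z)
    linarith
  calc ∑ y, k x y * (∑ z, heatNumerator k q z y - ∑ z, heatNumerator k q z x)
      = ∑ z, ∑ y, k x y * (heatNumerator k q z y - heatNumerator k q z x) := by
        rw [Finset.sum_comm]
        refine Finset.sum_congr rfl fun y _ => ?_
        rw [← Finset.sum_sub_distrib, Finset.mul_sum]
    _ = _ := by
        rw [← Finset.add_sum_erase _ _ (Finset.mem_univ x), hdiag,
          Finset.sum_congr rfl fun z hz => hoff z x (Finset.ne_of_mem_erase hz).symm,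
          Finset.sum_neg_distrib, ← Finset.sum_mul,
          ← Finset.add_sum_erase _ w (Finset.mem_univ x)]
        ring

end Bounds

/-! ### The quasipotential -/

theorem SimpleGraph.Connected.abs_sub_le_card_mul {V : Type*} [Fintype V] {G : SimpleGraph V}
    (hconn : G.Connected) {f : V → ℝ} {B : ℝ} (hB : 0 ≤ B)
    (h : ∀ x y, G.Adj x y → |f x - f y| ≤ B) (x y : V) :
    |f x - f y| ≤ Fintype.card V * B := by
  have hw : ∀ {x y : V} (p : G.Walk x y), |f x - f y| ≤ p.length * B := by
    intro x y p
    induction p with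
    | nil => simp
    | @cons a b c hab p ih =>
      have := abs_sub_le (f a) (f b) (f c)
      have := h a b hab
      rw [SimpleGraph.Walk.length_cons]
      push_cast
      linarith
  obtain ⟨p, hp⟩ := (hconn.preconnected x y).exists_isPath
  refine (hw p).trans (mul_le_mul_of_nonneg_right ?_ hB)
  exact_mod_cast hp.length_lt.le

namespace JumpModel

open Classical

variable {V : Type*} [Fintype V] {n : ℕ} (M : JumpModel V n)
  {β : ℝ} {α : EuclideanSpace ℝ (Fin n)}

/-- The heat, set to zero off the edges. -/
noncomputable def edgeHeat (α : EuclideanSpace ℝ (Fin n)) (x y : V) : ℝ :=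
  if M.graph.Adj x y then M.heat α x y else 0

theorem edgeHeat_antisymm (hα : α ∈ M.params) (x y : V) :
    M.edgeHeat α x y = -M.edgeHeat α y x := by
  by_cases h : M.graph.Adj x y
  · rw [edgeHeat, edgeHeat, if_pos h, if_pos h.symm,
      ← M.local_detailed_balance 1 one_pos α hα x y h,
      ← M.local_detailed_balance 1 one_pos α hα y x h.symm, ← inv_div (M.rate 1 α y x), Real.log_inv]
    ring
  · rw [edgeHeat, edgeHeat, if_neg h, if_neg (mt SimpleGraph.Adj.symm h), neg_zero]

theorem edgeHeat_self (x : V) : M.edgeHeat α x x = 0 := if_neg (M.graph.loopless.irrefl x)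

theorem power_eq (hβ : 0 < β) (hα : α ∈ M.params) (x : V) :
    M.power β α x = ∑ y, M.rate β α x y * M.edgeHeat α x y := by
  refine Finset.sum_congr rfl fun y _ => ?_
  by_cases h : M.graph.Adj x y
  · rw [edgeHeat, if_pos h]
  · rw [M.rate_eq_zero β hβ α hα x y h, zero_mul, zero_mul]

theorem generator_mulVec (hβ : 0 < β) (hα : α ∈ M.params) (u : V → ℝ) (x : V) :
    (M.generator β α).mulVec u x = ∑ y, M.rate β α x y * (u y - u x) := by
  have h0 : M.rate β α x x = 0 := M.rate_eq_zero β hβ α hα x x (M.graph.loopless.irrefl x)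
  simp only [Matrix.mulVec, dotProduct, generator, Matrix.of_apply]
  rw [← Finset.add_sum_erase _ _ (Finset.mem_univ x), if_pos rfl, mul_comm]
  simp only [mul_sub, Finset.sum_sub_distrib, ← Finset.sum_mul]
  rw [← Finset.add_sum_erase _ (fun y => M.rate β α x y * u y) (Finset.mem_univ x), h0]
  have h : ∀ y ∈ Finset.univ.erase x, (if x = y then -∑ z, M.rate β α x z else M.rate β α x y) * u y
      = M.rate β α x y * u y := fun y hy => by rw [if_neg (Finset.ne_of_mem_erase hy).symm]
  rw [Finset.sum_congr rfl h]
  ring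

theorem stationaryDist_pos (hβ : 0 < β) (hα : α ∈ M.params) (x : V) :
    0 < stationaryDist (M.rate β α) x := by
  have hρ := M.isStationaryDist_stationaryDist hβ hα
  obtain ⟨y, -, hy⟩ : ∃ y ∈ Finset.univ, 0 < stationaryDist (M.rate β α) y :=
    Finset.exists_lt_of_sum_lt (f := fun _ => (0 : ℝ)) (by
      rw [hρ.sum_eq_one, Finset.sum_const_zero]; exact one_pos)
  exact M.pos_of_solvesMasterEq hβ hα hρ.nonneg hρ.master hy x

theorem meanPower_eq : M.meanPower β α =
    ∑ y, stationaryDist (M.rate β α) y * M.power β α y :=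
  Finset.sum_congr rfl fun _ _ => mul_comm _ _

theorem integrableOn_excessPower (hβ : 0 < β) (hα : α ∈ M.params) (x : V) :
    IntegrableOn (M.excessPower β α x) (Set.Ioi 0) := by
  have := integrableOn_exp_smul_mulVec_sub (M.generator_mulVec hβ hα)
    (M.isStationaryDist_stationaryDist hβ hα) (M.stationaryDist_pos hβ hα)
    (M.rate_nonneg hβ hα) M.connected (M.rate_pos β hβ α hα) (M.power β α) x
  rw [← meanPower_eq] at this
  exact this

theorem treeWeight_pos (hβ : 0 < β) (hα : α ∈ M.params) (z : V) :
    0 < treeWeight (M.rate β α) z :=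
  _root_.treeWeight_pos (M.rate_nonneg hβ hα) (M.rate_pos β hβ α hα) M.connected z

theorem sum_treeWeight_pos (hβ : 0 < β) (hα : α ∈ M.params) :
    0 < ∑ z, treeWeight (M.rate β α) z :=
  Finset.sum_pos (fun z _ => M.treeWeight_pos hβ hα z)
    (Finset.univ_nonempty_iff.2 M.connected.nonempty)

theorem stationaryDist_eq (hβ : 0 < β) (hα : α ∈ M.params) (x : V) :
    stationaryDist (M.rate β α) x
      = (∑ z, treeWeight (M.rate β α) z)⁻¹ * treeWeight (M.rate β α) x := by
  have hW := M.sum_treeWeight_pos hβ hα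
  refine congrFun (M.isStationaryDist_unique hβ hα (M.isStationaryDist_stationaryDist hβ hα)
    (σ := fun x => (∑ z, treeWeight (M.rate β α) z)⁻¹ * treeWeight (M.rate β α) x)
    ⟨fun x => mul_nonneg (inv_nonneg.2 hW.le) (M.treeWeight_pos hβ hα x).le, ?_,
      (solvesMasterEq_treeWeight _).smul _⟩) x
  rw [← Finset.mul_sum, inv_mul_cancel₀ hW.ne']

/-- The quasipotential is, up to a constant, the mean heat released until reaching an independent
stationary target. -/
theorem exists_quasipotential_eq (hβ : 0 < β) (hα : α ∈ M.params) :
    ∃ m : ℝ, (∀ x, M.quasipotential β α x = (∑ z, treeWeight (M.rate β α) z)⁻¹ *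
        (∑ z, heatNumerator (M.rate β α) (M.edgeHeat α) z x) - m) ∧
      ∑ x, stationaryDist (M.rate β α) x * M.quasipotential β α x = 0 := by
  set W := ∑ z, treeWeight (M.rate β α) z with hW
  have hWpos : 0 < W := M.sum_treeWeight_pos hβ hα
  set N : V → ℝ := fun x => ∑ z, heatNumerator (M.rate β α) (M.edgeHeat α) z x with hN
  have hρ := M.isStationaryDist_stationaryDist hβ hα
  set m := ∑ x, stationaryDist (M.rate β α) x * (W⁻¹ * N x) with hm
  have h0 : ∑ x, stationaryDist (M.rate β α) x * (W⁻¹ * N x - m) = 0 := by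
    simp only [mul_sub, Finset.sum_sub_distrib, ← Finset.sum_mul, hρ.sum_eq_one]
    rw [hm]
    ring
  have hP : ∀ x, ∑ y, M.rate β α x y * ((W⁻¹ * N y - m) - (W⁻¹ * N x - m))
      = (∑ y, stationaryDist (M.rate β α) y * M.power β α y) - M.power β α x := by
    intro x
    have h1 := sum_mul_sum_heatNumerator_sub (M.edgeHeat_self (α := α))
      (M.treeWeight_pos hβ hα) x
    simp only [← M.power_eq hβ hα] at h1
    calc ∑ y, M.rate β α x y * ((W⁻¹ * N y - m) - (W⁻¹ * N x - m))
        = W⁻¹ * ∑ y, M.rate β α x y * (N y - N x) := by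
          refine Eq.symm ((Finset.mul_sum _ _ _).trans ?_)
          exact Finset.sum_congr rfl fun y _ => by ring
      _ = W⁻¹ * (∑ z, treeWeight (M.rate β α) z * M.power β α z - W * M.power β α x) := by
          rw [← h1]
      _ = _ := by
          rw [mul_sub, inv_mul_cancel_left₀ hWpos.ne', Finset.mul_sum]
          congr 1
          refine Finset.sum_congr rfl fun z _ => ?_
          rw [M.stationaryDist_eq hβ hα, mul_assoc]
  have hV : ∀ x, M.quasipotential β α x = W⁻¹ * N x - m := by
    intro x
    have := integral_exp_smul_mulVec_sub (M.generator_mulVec hβ hα) hρ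
      (M.stationaryDist_pos hβ hα) (M.rate_nonneg hβ hα) M.connected (M.rate_pos β hβ α hα)
      h0 hP x
    rw [← meanPower_eq] at this
    exact this
  exact ⟨m, hV, by simpa only [hV] using h0⟩

theorem exists_phiStar_eq (α : EuclideanSpace ℝ (Fin n)) :
    ∃ (z : V) (T : SimpleGraph V), IsSpanningTree M.graph T ∧
      M.phiStar α = M.phiSub α (rootedTree T z) := by
  have := M.connected.nonempty
  obtain ⟨T₀, hT₀⟩ := M.connected.exists_isTree_le
  have : Nonempty {T : SimpleGraph V // IsSpanningTree M.graph T} := ⟨⟨T₀, hT₀⟩⟩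
  obtain ⟨z, hz⟩ := exists_eq_ciSup_of_finite (f := fun z => M.phiVertex α z)
  obtain ⟨T, hT⟩ := exists_eq_ciSup_of_finite
    (f := fun T : {T : SimpleGraph V // IsSpanningTree M.graph T} =>
      M.phiSub α (rootedTree T.1 z))
  exact ⟨z, T.1, T.2, hz.symm.trans hT.symm⟩

/-- The tree weights are bounded below by the dominant tree. -/
theorem le_sum_treeWeight {c : ℝ} (hβ : 0 < β) (hα : α ∈ M.params) (hc : 0 ≤ c)
    (h : ∀ x y, M.graph.Adj x y → c * Real.exp (β * M.phi α x y) ≤ M.rate β α x y) :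
    c ^ (Fintype.card V - 1) * Real.exp (β * M.phiStar α)
      ≤ ∑ z, treeWeight (M.rate β α) z := by
  obtain ⟨z, T, hT, hφ⟩ := M.exists_phiStar_eq α
  obtain ⟨g, hz, hR, hadj, hgT⟩ := exists_rooted_of_isTree hT.2 z
  rw [hφ, hgT]
  refine (le_rootedWeight hc (fun v hv => hT.1 (hadj v hv)) h).trans ?_
  refine (rootedWeight_le_treeWeight (M.rate_nonneg hβ hα) hz hR).trans ?_
  exact Finset.single_le_sum (fun z _ => (M.treeWeight_pos hβ hα z).le) (Finset.mem_univ z)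

/-- A map with a root has `Fintype.card V - 1` arrows, so comparing a tree-loop-tree with the
dominant tree costs only that power of `C / c`; the exponentials are handled by the no-delay
condition. -/
theorem abs_quasipotential_sub_le {S : Set (EuclideanSpace ℝ (Fin n))} (hdelay : M.NoDelay S)
    {c C Q : ℝ} (hβ : 0 < β) (hαS : α ∈ S) (hα : α ∈ M.params) (hc : 0 < c) (hC : 0 < C)
    (hQ : ∀ x y, M.graph.Adj x y → |M.heat α x y| ≤ Q) (hQ0 : 0 ≤ Q)
    (h : ∀ x y, M.graph.Adj x y → c * Real.exp (β * M.phi α x y) ≤ M.rate β α x y ∧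
      M.rate β α x y ≤ C * Real.exp (β * M.phi α x y)) {x y : V} (hxy : M.graph.Adj x y) :
    |M.quasipotential β α x - M.quasipotential β α y| ≤
      Fintype.card V * (Fintype.card (V → V) *
        ((2 + C ^ (Fintype.card V - 1) / c ^ (Fintype.card V - 1)) * (Fintype.card V * Q))) := by
  obtain ⟨m, hV, -⟩ := M.exists_quasipotential_eq hβ hα
  have hWpos := M.sum_treeWeight_pos hβ hα
  have hlow := M.le_sum_treeWeight hβ hα hc.le fun x y hxy => (h x y hxy).1
  set W := ∑ z, treeWeight (M.rate β α) z with hW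
  have hQ' : ∀ x y, |M.edgeHeat α x y| ≤ Q := by
    intro x y
    by_cases hxy : M.graph.Adj x y
    · rw [edgeHeat, if_pos hxy]; exact hQ x y hxy
    · rw [edgeHeat, if_neg hxy, abs_zero]; exact hQ0
  have key := abs_sum_heatNumerator_sub_le (A := C ^ (Fintype.card V - 1) / c ^ (Fintype.card V - 1))
    (M.rate_nonneg hβ hα) (M.rate_eq_zero β hβ α hα)
    (M.edgeHeat_antisymm hα) hQ' (by positivity) (fun z g hadj hD => ?_)
    (fun z => (M.treeWeight_pos hβ hα z).le) hxy
  · rw [hV, hV, sub_sub_sub_cancel_right, ← mul_sub, abs_mul, abs_of_pos (inv_pos.2 hWpos),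
      inv_mul_le_iff₀ hWpos, mul_comm W]
    exact key
  · refine (rootedWeight_le (M.rate_nonneg hβ hα) hadj fun x y hxy => (h x y hxy).2).trans ?_
    have hφ : M.phiSub α (mapEdges g z) ≤ M.phiStar α := hdelay α hαS _ hxy _ hD
    rw [div_mul_eq_mul_div, mul_div_assoc]
    refine mul_le_mul_of_nonneg_left ?_ (by positivity)
    rw [le_div_iff₀ (by positivity), mul_comm]
    refine le_trans (mul_le_mul_of_nonneg_left ?_ (by positivity)) hlow
    exact Real.exp_le_exp.2 (mul_le_mul_of_nonneg_left hφ hβ.le)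

/-- With stationary mean zero, the value at `x` is an average of differences, each controlled along
a path. -/
theorem abs_quasipotential_le {B : ℝ} (hβ : 0 < β) (hα : α ∈ M.params) (hB : 0 ≤ B)
    (h : ∀ x y, M.graph.Adj x y → |M.quasipotential β α x - M.quasipotential β α y| ≤ B)
    (x : V) : |M.quasipotential β α x| ≤ Fintype.card V * B := by
  obtain ⟨-, -, h0⟩ := M.exists_quasipotential_eq hβ hα
  have hρ := M.isStationaryDist_stationaryDist hβ hα
  have hx : M.quasipotential β α x = ∑ y, stationaryDist (M.rate β α) y *
      (M.quasipotential β α x - M.quasipotential β α y) := by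
    simp only [mul_sub, Finset.sum_sub_distrib, ← Finset.sum_mul, hρ.sum_eq_one, h0]
    ring
  rw [hx]
  calc _ ≤ ∑ y, |stationaryDist (M.rate β α) y *
        (M.quasipotential β α x - M.quasipotential β α y)| := Finset.abs_sum_le_sum_abs _ _
    _ ≤ ∑ y, stationaryDist (M.rate β α) y * (Fintype.card V * B) := by
        refine Finset.sum_le_sum fun y _ => ?_
        rw [abs_mul, abs_of_nonneg (hρ.nonneg y)]
        exact mul_le_mul_of_nonneg_left (M.connected.abs_sub_le_card_mul hB h x y) (hρ.nonneg y)
    _ = _ := by rw [← Finset.sum_mul, hρ.sum_eq_one, one_mul]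

end JumpModel

theorem mainTheorem5 {V : Type*} [Fintype V] {n : ℕ} (M : JumpModel V n)
    (S : Set (EuclideanSpace ℝ (Fin n))) (hS : S ⊆ M.params)
    (hheat : ∃ Q : ℝ, ∀ α ∈ S, ∀ x y, M.graph.Adj x y → |M.heat α x y| ≤ Q)
    (hlow : M.LowTemperatureAsymptotics S)
    (hdelay : M.NoDelay S) :
    (∀ β > 0, ∀ α ∈ M.params, ∀ x, IntegrableOn (M.excessPower β α x) (Set.Ioi 0)) ∧
    (∃ B : ℝ, ∃ β₀ > 0, ∀ β ≥ β₀, ∀ α ∈ S, ∀ x y, M.graph.Adj x y →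
      |M.quasipotential β α x - M.quasipotential β α y| ≤ B) ∧
    (∃ B : ℝ, ∃ β₀ > 0, ∀ β ≥ β₀, ∀ α ∈ S, ∀ x, |M.quasipotential β α x| ≤ B) := by
  classical
  obtain ⟨Q, hQ⟩ := hheat
  obtain ⟨c, hc, C, hC, β₀, hβ₀, h⟩ := hlow
  obtain ⟨B, hB0, hB⟩ : ∃ B : ℝ, 0 ≤ B ∧ ∀ β ≥ β₀, ∀ α ∈ S, ∀ x y, M.graph.Adj x y →
      |M.quasipotential β α x - M.quasipotential β α y| ≤ B :=
    -- `|Q|` replaces `Q`, which may be negative if there are no edges or `S` is empty.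
    ⟨Fintype.card V * (Fintype.card (V → V) *
        ((2 + C ^ (Fintype.card V - 1) / c ^ (Fintype.card V - 1)) * (Fintype.card V * |Q|))),
      by positivity, fun β hβ α hα x y hxy =>
      M.abs_quasipotential_sub_le hdelay (hβ₀.trans_le hβ) hα (hS hα) hc hC
        (fun x y hxy => (hQ α hα x y hxy).trans (le_abs_self Q)) (abs_nonneg Q)
        (h β hβ α hα) hxy⟩
  exact ⟨fun β hβ α hα x => M.integrableOn_excessPower hβ hα x, ⟨B, β₀, hβ₀, hB⟩,
    Fintype.card V * B, β₀, hβ₀, fun β hβ α hα x =>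
      M.abs_quasipotential_le (hβ₀.trans_le hβ) (hS hα) hB0 (hB β hβ α hα) x⟩
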